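/- Let $n\ge 2$ and let $P=\mathbb{R}^n$ carry a rotationally symmetric metric which in geodesic polar coordinates about the origin $o$ is $g_0=dr^2+\xi(r)^2\,d\vartheta^2$, where $d\vartheta^2$ is the round metric of $\mathbb{S}^{n-1}$ and $\xi:\mathbb{R}\to\mathbb{R}$ is a smooth odd function with $\xi>0$ on $(0,\infty)$ and $\xi'(0)=1$. Suppose that the sectional curvatures $K$ of $g_0$ satisfy $K_-\le K\le K_+<0$ for some constants $K_-,K_+$, and that $(\xi/\xi')'(r)\to 0$ as $r\to+\infty$. Let $c\in\mathbb{R}$, $\varepsilon\ge 0$, and let $M_\varepsilon\subset\mathbb{R}\times P$ be a complete rotationally symmetric translating soliton with velocity $c$, that is, $M_\varepsilon$ satisfies $H=c\langle\partial_t,N\rangle$ (with $H$ the non-normalized mean curvature with respect to the unit normal $N$, in the product metric $dt^2+g_0$), and $M_\varepsilon$ is the image of $\mathbb{R}\times\mathbb{S}^{n-1}$ under $(s,\vartheta)\mapsto(t(s),r(s)\vartheta)$, for a profile curve $s\in\mathbb{R}\mapsto(r(s),t(s))$ of class $C^2$, parametrized by arc length, with $r(0)=\varepsilon$, such that - if $\varepsilon>0$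 (wing-like soliton): $\dot r(0)=0$ and $r(s)>0$ for all $s$; - if $\varepsilon=0$ (bowl soliton): $\dot r(0)=1$, $r(s)>0$ for $s>0$, and the curve is symmetric under reflection in the axis, i.e. $r(-s)=-r(s)$ and $t(-s)=t(s)$. Then there is $R>0$ such that, outside the cylinder $\mathbb{R}\times \bar B_R(o)$ over a geodesic ball: - if $\varepsilon=0$, $M_0$ is the graph $\{(u(|x|),x)\}$ of one radial function $u$ on $\{|x|>R\}$; - if $\varepsilon>0$, $M_\varepsilon$ is a bi-graph, i.e. the union of the graphs of two radial functions $u_2<u_1$ on $\{|x|>R\}$; and each of the functions $u$, $u_1$, $u_2$ is differentiable on $(R,\infty)$ and satisfies $$u'(r)=\frac{c}{n-1}\,\frac{\xi(r)}{\xi'(r)}+o\!\left(\frac{\xi'(r)}{\xi(r)}\right)\qquad\text{as } r\to+\infty .$$ -/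

import Mathlib

open Filter Topology Asymptotics
open scoped ContDiff

noncomputable section

/-! ### Riemannian geometry in one global chart

A metric on a real vector space `E` is a map `g : E → E → E → ℝ`, where `g x v w` is the inner
product of the tangent vectors `v, w` at the point `x`. -/

/-- The Christoffel vector `Γ_x(u, v)`, i.e. the Levi-Civita derivative `∇_u v` at `x` of the constant
vector field `v`: the vector `Z` (unique, as `g x` is nondegenerate) with
`g(Z, w) = (u g(v, w) + v g(u, w) - w g(u, v)) / 2` for all `w`. -/
def christoffel {E : Type*} [NormedAddCommGroup E] [NormedSpace ℝ E]
    (g : E → E → E → ℝ) (x u v : E) : E :=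
  Classical.epsilon fun Z : E => ∀ w : E, g x Z w =
    (lineDeriv ℝ (fun y => g y v w) x u + lineDeriv ℝ (fun y => g y u w) x v
      - lineDeriv ℝ (fun y => g y u v) x w) / 2

/-- The curvature `R(u, v) w = ∇_u ∇_v w - ∇_v ∇_u w` at `x`, for constant fields `u, v, w`. -/
def riemannCurvature {E : Type*} [NormedAddCommGroup E] [NormedSpace ℝ E]
    (g : E → E → E → ℝ) (x u v w : E) : E :=
  (lineDeriv ℝ (fun y => christoffel g y v w) x u + christoffel g x u (christoffel g x v w))
    - (lineDeriv ℝ (fun y => christoffel g y u w) x v + christoffel g x v (christoffel g x u w))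

/-- The sectional curvature of the plane spanned by the linearly independent vectors `u, v`
at `x`. -/
def sectionalCurvature {E : Type*} [NormedAddCommGroup E] [NormedSpace ℝ E]
    (g : E → E → E → ℝ) (x u v : E) : ℝ :=
  g x (riemannCurvature g x u v v) u / (g x u u * g x v v - g x u v ^ 2)

/-- The Levi-Civita acceleration `∇_{α'} α'` of the curve `α` at the time `0`. -/
def covAccel {E : Type*} [NormedAddCommGroup E] [NormedSpace ℝ E]
    (g : E → E → E → ℝ) (α : ℝ → E) : E :=
  deriv (deriv α) 0 + christoffel g (α 0) (deriv α 0) (deriv α 0)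

/-- The map `ψ`, on the `m`-dimensional parameter manifold `S ⊆ A`, is a hypersurface of `(E, g)`
with `H = c ⟨X, N⟩`. Here `N` is a unit normal at `ψ p` and `H` is the (non-normalized) mean
curvature, the trace of the second fundamental form `II(v, v) = ⟨∇_{α'} α', N⟩`, where `α` is the
image of a curve in `S` and `v = α'(0)`: so `H` is the sum of `II(eᵢ, eᵢ)` over any orthonormal
basis `e₁, …, eₘ` of the tangent space. -/
def IsTranslatingSoliton {A E : Type*} [NormedAddCommGroup A] [NormedSpace ℝ A]
    [NormedAddCommGroup E] [NormedSpace ℝ E]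
    (g : E → E → E → ℝ) (X : E) (c : ℝ) (m : ℕ) (S : Set A) (ψ : A → E) : Prop :=
  ∀ p ∈ S, ∀ N : E, g (ψ p) N N = 1 →
    ∀ γ : Fin m → ℝ → A,
      (∀ i, ContDiff ℝ 2 (γ i) ∧ (∀ h, γ i h ∈ S) ∧ γ i 0 = p) →
      (∀ i j, g (ψ p) (deriv (ψ ∘ γ i) 0) (deriv (ψ ∘ γ j) 0) = if i = j then 1 else 0) →
      (∀ i, g (ψ p) (deriv (ψ ∘ γ i) 0) N = 0) →
      ∑ i, g (ψ p) (covAccel g (ψ ∘ γ i)) N = c * g (ψ p) X N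

/-! ### Rotationally symmetric metrics -/

/-- The functions `ξ` such that `dr² + ξ(r)² dϑ²` is a smooth metric in geodesic polar coordinates
(a smooth odd function is one all of whose even derivatives vanish at `0`, up to its irrelevant
values at negative `r`). -/
structure IsWarpingFunction (ξ : ℝ → ℝ) : Prop where
  smooth : ContDiff ℝ ∞ ξ
  odd : ∀ r, ξ (-r) = -ξ r
  pos : ∀ r, 0 < r → 0 < ξ r
  deriv_zero : deriv ξ 0 = 1

open scoped Classical in
/-- The metric `g₀ = dr² + ξ(r)² dϑ²` on `P = ℝⁿ`, in the Cartesian coordinates `x = r ϑ` with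
`r = ‖x‖`, `ϑ ∈ S^{n-1}`: a tangent vector `v` at `x ≠ 0` has `dr(v) = ⟨x, v⟩ / r`, and `dϑ(v)` is
`1 / r` times the part of `v` orthogonal to `x`. At the origin it is the Euclidean product. The
geodesic ball `B_R(o)` is `{x | ‖x‖ < R}`. -/
def rotMetric (n : ℕ) (ξ : ℝ → ℝ) (x v w : EuclideanSpace ℝ (Fin n)) : ℝ :=
  if x = 0 then inner ℝ v w
  else (inner ℝ x v / ‖x‖) * (inner ℝ x w / ‖x‖)
    + ξ ‖x‖ ^ 2 * ((inner ℝ v w - (inner ℝ x v / ‖x‖) * (inner ℝ x w / ‖x‖)) / ‖x‖ ^ 2)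

/-- The product metric `dt² + g` on `ℝ × E`. -/
def prodMetric {E : Type*} (g : E → E → E → ℝ) (p a b : ℝ × E) : ℝ :=
  a.1 * b.1 + g p.2 a.2 b.2

/-! ### Rotationally symmetric translating solitons -/

/-- The rotation `(s, ϑ) ↦ (t(s), r(s) ϑ)` of a profile curve `s ↦ (r(s), t(s))`. -/
def rotMap {n : ℕ} (r t : ℝ → ℝ) (p : ℝ × EuclideanSpace ℝ (Fin n)) :
    ℝ × EuclideanSpace ℝ (Fin n) :=
  (t p.1, r p.1 • p.2)

/-- The parameter manifold `ℝ × S^{n-1}`. -/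
def rotParam (n : ℕ) : Set (ℝ × EuclideanSpace ℝ (Fin n)) :=
  {p | ‖p.2‖ = 1}

/-- `M` is (a vertical translate of) the complete rotationally symmetric translating soliton `M_ε`
in `ℝ × P`, with velocity `c` and with profile curve `s ↦ (r(s), t(s))` parametrized by arc length.
* `ε > 0`: the curve stays off the axis, and starts at `r = ε` in a vertical direction;
* `ε = 0`: the curve starts on the axis in the horizontal direction. It is continued to `s < 0` by
  reflection in the axis, and is `C²` there; at points of the axis the rotation map is not an
  immersion and the equation holds by continuity. -/
structure IsRotSoliton (n : ℕ) (ξ : ℝ → ℝ) (c ε : ℝ)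
    (M : Set (ℝ × EuclideanSpace ℝ (Fin n))) (r t : ℝ → ℝ) : Prop where
  contDiff_r : ContDiff ℝ 2 r
  contDiff_t : ContDiff ℝ 2 t
  arclength : ∀ s, deriv r s ^ 2 + deriv t s ^ 2 = 1
  start : r 0 = ε
  wing : 0 < ε → deriv r 0 = 0 ∧ ∀ s, 0 < r s
  bowl : ε = 0 → deriv r 0 = 1 ∧ (∀ s, 0 < s → 0 < r s) ∧
    (∀ s, r (-s) = -r s) ∧ (∀ s, t (-s) = t s)
  soliton : IsTranslatingSoliton (prodMetric (rotMetric n ξ)) (1, 0) c n (rotParam n) (rotMap r t)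
  image : M = rotMap r t '' rotParam n

/-! ### The asymptotic behaviour -/

/-- `u` is differentiable for `r > R`, and `u' = c/(n-1) ξ/ξ' + o(ξ'/ξ)` as `r → ∞`. -/
def HasSolitonSlope (n : ℕ) (ξ : ℝ → ℝ) (c R : ℝ) (u : ℝ → ℝ) : Prop :=
  (∀ r, R < r → DifferentiableAt ℝ u r) ∧
  (fun r => deriv u r - c / ((n : ℝ) - 1) * (ξ r / deriv ξ r)) =o[atTop]
    (fun r => deriv ξ r / ξ r)

end

/-!
Let `q = ξ' / ξ` and `m = n - 1`. Away from the origin the Koszul formula for `g₀` has an explicit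
solution (`christoffel_rotMetric`), from which one reads off that planes containing the radial
direction have curvature `-ξ'' / ξ` (`sectionalCurvature_radial`), and that testing the soliton
equation on the meridian and on `m` orthogonal parallels gives
`ẗ ṙ - r̈ ṫ + m q(r) ṫ = c ṙ` for the profile curve (`profile_equation`).

The bound `K ≤ K₊ < 0` gives `q ≥ √(-K₊)` (`sqrt_le_log_deriv_warping`). Where the
curve is vertical, `r̈ = m q(r) > 0`, so `ṙ` changes sign at most once and `ṙ > 0` for `s > 0`; the
same computation for nearly vertical directions bounds `ṙ` away from zero, so `r → ∞`
(`IsProfile.isOutgoing`, `IsProfile.tendsto_r`). Hence each half of the curve is a radial graph.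

Its slope `p = ṫ / ṙ` satisfies `dp/ds = -(m q / ṙ) (p - p∗)` with `p∗ = (c / m) ξ / ξ'`. As
`dp∗/dr → 0` by hypothesis and `m q / ṙ ≥ m √(-K₊)`, the difference `p - p∗` tends to `0`
(`tendsto_zero_of_forced_decay`), which is `o(q)` because `q` is bounded below.

For a wing, the slopes of the two halves solve the same equation `p' = (1 + p²) (c - m q p)` in `r`
and start from `+∞` and `-∞`; their difference never vanishes, so the sheets separate
(`graph_lt_graph`).
-/

/-! ### The Levi-Civita connection of a rotationally symmetric metric -/

/-- A vector representing the Koszul functional is the Christoffel vector, when the metric is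
nondegenerate at the point. -/
theorem christoffel_eq {E : Type*} [NormedAddCommGroup E] [NormedSpace ℝ E]
    {g : E → E → E → ℝ} {x u v Z : E}
    (hnd : ∀ Z' : E, (∀ w, g x Z' w = g x Z w) → Z' = Z)
    (hZ : ∀ w : E, g x Z w = (lineDeriv ℝ (fun y => g y v w) x u
      + lineDeriv ℝ (fun y => g y u w) x v - lineDeriv ℝ (fun y => g y u v) x w) / 2) :
    christoffel g x u v = Z := by
  refine hnd _ fun w => ?_
  rw [hZ w]
  exact Classical.epsilon_spec (p := fun Z : E => ∀ w : E, g x Z w =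
    (lineDeriv ℝ (fun y => g y v w) x u + lineDeriv ℝ (fun y => g y u w) x v
      - lineDeriv ℝ (fun y => g y u v) x w) / 2) ⟨Z, hZ⟩ w

theorem hasDerivAt_norm_line {E : Type*} [NormedAddCommGroup E] [InnerProductSpace ℝ E]
    {x : E} (hx : x ≠ 0) (u : E) :
    HasDerivAt (fun h : ℝ => ‖x + h • u‖) (inner ℝ x u / ‖x‖) 0 := by
  have h1 : HasDerivAt (fun h : ℝ => x + h • u) u 0 := by
    simpa using ((hasDerivAt_id (0 : ℝ)).smul_const u).const_add x
  have h2 := (h1.norm_sq).sqrt (by simpa using hx)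
  simp only [Real.sqrt_sq (norm_nonneg _), zero_smul, add_zero] at h2
  convert h2 using 1
  have : ‖x‖ ≠ 0 := norm_ne_zero_iff.2 hx
  field_simp

theorem hasDerivAt_inner_line {E : Type*} [NormedAddCommGroup E] [InnerProductSpace ℝ E]
    (x u v : E) : HasDerivAt (fun h : ℝ => inner ℝ (x + h • u) v) (inner ℝ u v) 0 := by
  have h1 : HasDerivAt (fun h : ℝ => x + h • u) u 0 := by
    simpa using ((hasDerivAt_id (0 : ℝ)).smul_const u).const_add x
  simpa using h1.inner ℝ (hasDerivAt_const (0 : ℝ) v)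

theorem eventually_line_ne_zero {E : Type*} [NormedAddCommGroup E] [NormedSpace ℝ E]
    {x : E} (hx : x ≠ 0) (u : E) : ∀ᶠ h : ℝ in 𝓝 0, x + h • u ≠ 0 := by
  have : ContinuousAt (fun h : ℝ => x + h • u) 0 := by fun_prop
  exact this.eventually_ne (by simpa using hx)

section Metric

variable {n : ℕ} {ξ : ℝ → ℝ}

theorem rotMetric_of_ne {x : EuclideanSpace ℝ (Fin n)} (hx : x ≠ 0)
    (v w : EuclideanSpace ℝ (Fin n)) :
    rotMetric n ξ x v w = (inner ℝ x v / ‖x‖) * (inner ℝ x w / ‖x‖)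
      + ξ ‖x‖ ^ 2 * ((inner ℝ v w - (inner ℝ x v / ‖x‖) * (inner ℝ x w / ‖x‖)) / ‖x‖ ^ 2) := by
  simp [rotMetric, hx]

/-- The derivative of `g₀(v, w)` in the direction `u`, for constant fields `v, w`. -/
theorem lineDeriv_rotMetric (hξ : IsWarpingFunction ξ) {x : EuclideanSpace ℝ (Fin n)}
    (hx : x ≠ 0) (u v w : EuclideanSpace ℝ (Fin n)) :
    lineDeriv ℝ (fun y => rotMetric n ξ y v w) x u =
      (1 - ξ ‖x‖ ^ 2 / ‖x‖ ^ 2) * ((inner ℝ u v * inner ℝ x w + inner ℝ x v * inner ℝ u w) / ‖x‖ ^ 2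
        - 2 * inner ℝ x v * inner ℝ x w * inner ℝ x u / ‖x‖ ^ 4)
      + (2 * ξ ‖x‖ * deriv ξ ‖x‖ / ‖x‖ - 2 * ξ ‖x‖ ^ 2 / ‖x‖ ^ 2) * inner ℝ x u / ‖x‖ ^ 2
        * (inner ℝ v w - inner ℝ x v * inner ℝ x w / ‖x‖ ^ 2) := by
  have hρ : ‖x‖ ≠ 0 := norm_ne_zero_iff.2 hx
  have hn := hasDerivAt_norm_line hx u
  have hξd : HasDerivAt ξ (deriv ξ ‖x‖) ‖x + (0 : ℝ) • u‖ := by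
    simpa using (hξ.smooth.differentiable (by simp) ‖x‖).hasDerivAt
  have h1 := (hasDerivAt_inner_line x u v).div hn (by simpa using hx)
  have h2 := (hasDerivAt_inner_line x u w).div hn (by simpa using hx)
  have h3 := ((hξd.comp 0 hn).pow 2).mul
    (((h1.mul h2).const_sub (inner ℝ v w)).div (hn.pow 2) (by simpa using hx))
  have h4 := (h1.mul h2).add h3
  have h5 := h4.congr_of_eventuallyEq (f₁ := fun h : ℝ => rotMetric n ξ (x + h • u) v w) (by
    filter_upwards [eventually_line_ne_zero hx u] with h hh
    rw [rotMetric_of_ne hh]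
    rfl)
  rw [lineDeriv, h5.deriv]
  simp
  field_simp
  ring

/-- The explicit Christoffel vector of `g₀` away from the origin. With `ρ = ‖x‖`, it is
`a (⟨x, u⟩ v + ⟨x, v⟩ u) + (d ⟨u, v⟩ - (2 a + d) / ρ² ⟨x, u⟩ ⟨x, v⟩) x` for
`a = (ξ' / ξ - 1 / ρ) / ρ` and `d = 1 / ρ² - ξ ξ' / ρ³`; the last coefficient is the one that makes
the rays from the origin geodesics. -/
noncomputable def rotChristoffel {E : Type*} [NormedAddCommGroup E] [InnerProductSpace ℝ E]
    (ξ : ℝ → ℝ) (x u v : E) : E :=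
  ((deriv ξ ‖x‖ / ξ ‖x‖ - 1 / ‖x‖) / ‖x‖) • (inner ℝ x u • v + inner ℝ x v • u)
    + ((1 / ‖x‖ ^ 2 - ξ ‖x‖ * deriv ξ ‖x‖ / ‖x‖ ^ 3) * inner ℝ u v
      - (2 * ((deriv ξ ‖x‖ / ξ ‖x‖ - 1 / ‖x‖) / ‖x‖)
        + (1 / ‖x‖ ^ 2 - ξ ‖x‖ * deriv ξ ‖x‖ / ‖x‖ ^ 3)) / ‖x‖ ^ 2
        * (inner ℝ x u * inner ℝ x v)) • x

theorem rotMetric_nondegenerate (hξ : IsWarpingFunction ξ) {x : EuclideanSpace ℝ (Fin n)}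
    (hx : x ≠ 0) {Z Z' : EuclideanSpace ℝ (Fin n)}
    (h : ∀ w, rotMetric n ξ x Z' w = rotMetric n ξ x Z w) : Z' = Z := by
  have hρ : ‖x‖ ≠ 0 := norm_ne_zero_iff.2 hx
  have hξ0 : ξ ‖x‖ ≠ 0 := (hξ.pos _ (norm_pos_iff.2 hx)).ne'
  -- testing against `x` gives the radial parts, then all vectors give the rest
  have e1 : (inner ℝ x Z' : ℝ) = inner ℝ x Z := by
    have := h x
    rw [rotMetric_of_ne hx, rotMetric_of_ne hx, real_inner_self_eq_norm_sq,
      real_inner_comm x Z', real_inner_comm x Z] at this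
    field_simp at this
    linarith
  refine ext_inner_right ℝ fun w => ?_
  have := h w
  rw [rotMetric_of_ne hx, rotMetric_of_ne hx, e1] at this
  field_simp at this
  have h2 : ξ ‖x‖ ^ 2 * ‖x‖ ^ 2 ≠ 0 := by positivity
  exact mul_left_cancel₀ h2 (by linarith)

/-- The Koszul formula for the explicit Christoffel vector. -/
theorem rotMetric_rotChristoffel (hξ : IsWarpingFunction ξ) {x : EuclideanSpace ℝ (Fin n)}
    (hx : x ≠ 0) (u v w : EuclideanSpace ℝ (Fin n)) :
    rotMetric n ξ x (rotChristoffel ξ x u v) w =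
      (lineDeriv ℝ (fun y => rotMetric n ξ y v w) x u
        + lineDeriv ℝ (fun y => rotMetric n ξ y u w) x v
        - lineDeriv ℝ (fun y => rotMetric n ξ y u v) x w) / 2 := by
  have hρ : ‖x‖ ≠ 0 := norm_ne_zero_iff.2 hx
  have hξ0 : ξ ‖x‖ ≠ 0 := (hξ.pos _ (norm_pos_iff.2 hx)).ne'
  rw [lineDeriv_rotMetric hξ hx, lineDeriv_rotMetric hξ hx, lineDeriv_rotMetric hξ hx,
    rotMetric_of_ne hx]
  simp only [rotChristoffel, inner_add_left, inner_add_right, real_inner_smul_left,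
    real_inner_smul_right, real_inner_self_eq_norm_sq]
  rw [real_inner_comm u v, real_inner_comm u w, real_inner_comm v w]
  field_simp
  ring

theorem christoffel_rotMetric (hξ : IsWarpingFunction ξ) {x : EuclideanSpace ℝ (Fin n)}
    (hx : x ≠ 0) (u v : EuclideanSpace ℝ (Fin n)) :
    christoffel (rotMetric n ξ) x u v = rotChristoffel ξ x u v :=
  christoffel_eq (fun _ h => rotMetric_nondegenerate hξ hx h)
    (rotMetric_rotChristoffel hξ hx u v)

theorem christoffel_prodMetric (hξ : IsWarpingFunction ξ)
    {p : ℝ × EuclideanSpace ℝ (Fin n)} (hp : p.2 ≠ 0) (a b : ℝ × EuclideanSpace ℝ (Fin n)) :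
    christoffel (prodMetric (rotMetric n ξ)) p a b = (0, rotChristoffel ξ p.2 a.2 b.2) := by
  have key : ∀ u v w : ℝ × EuclideanSpace ℝ (Fin n),
      lineDeriv ℝ (fun y => prodMetric (rotMetric n ξ) y v w) p u =
        lineDeriv ℝ (fun y => rotMetric n ξ y v.2 w.2) p.2 u.2 := by
    intro u v w
    simp only [lineDeriv, prodMetric, Prod.snd_add, Prod.smul_snd, deriv_const_add]
  refine christoffel_eq (fun Z' h => ?_) fun w => ?_
  · have h0 : ∀ v : EuclideanSpace ℝ (Fin n), rotMetric n ξ p.2 v 0 = 0 := by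
      intro v; rw [rotMetric_of_ne hp]; simp
    refine Prod.ext ?_ (rotMetric_nondegenerate hξ hp fun w => ?_)
    · simpa [prodMetric, h0] using h (1, 0)
    · simpa [prodMetric] using h (0, w)
  · rw [key, key, key, ← rotMetric_rotChristoffel hξ hp]
    simp [prodMetric]

/-! ### The radial sectional curvature -/

theorem contDiff_two_hasDerivAt {f : ℝ → ℝ} (hf : ContDiff ℝ 2 f) (s : ℝ) :
    HasDerivAt f (deriv f s) s :=
  (hf.differentiable (by simp) s).hasDerivAt

theorem contDiff_two_hasDerivAt_deriv {f : ℝ → ℝ} (hf : ContDiff ℝ 2 f) (s : ℝ) :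
    HasDerivAt (deriv f) (deriv (deriv f) s) s := by
  have h' : ContDiff ℝ (1 + 1) f := by simpa [one_add_one_eq_two] using hf
  exact ((contDiff_succ_iff_deriv.1 h').2.2.differentiable (by simp) s).hasDerivAt

theorem hasDerivAt_deriv_warping (hξ : IsWarpingFunction ξ) (ρ : ℝ) :
    HasDerivAt (deriv ξ) (deriv (deriv ξ) ρ) ρ :=
  contDiff_two_hasDerivAt_deriv (contDiff_infty.1 hξ.smooth 2) ρ

theorem hasDerivAt_warping (hξ : IsWarpingFunction ξ) (ρ : ℝ) :
    HasDerivAt ξ (deriv ξ ρ) ρ :=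
  (hξ.smooth.differentiable (by simp) ρ).hasDerivAt

/-- The derivative `∂_x Γ(v, v)` for `v ⊥ x`: along the ray through `x`, the vector `Γ(v, v)` stays
radial. -/
theorem lineDeriv_christoffel_radial (hξ : IsWarpingFunction ξ) {x v : EuclideanSpace ℝ (Fin n)}
    (hx : x ≠ 0) (hxv : inner ℝ x v = 0) :
    lineDeriv ℝ (fun y => christoffel (rotMetric n ξ) y v v) x x =
    (‖v‖ ^ 2 * (-1 / ‖x‖ ^ 2 - (deriv ξ ‖x‖ ^ 2 + ξ ‖x‖ * deriv (deriv ξ) ‖x‖) / ‖x‖ ^ 2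
      + 2 * ξ ‖x‖ * deriv ξ ‖x‖ / ‖x‖ ^ 3)) • x := by
  have hρ : ‖x‖ ≠ 0 := norm_ne_zero_iff.2 hx
  have hξ0 : ξ ‖x‖ ≠ 0 := (hξ.pos _ (norm_pos_iff.2 hx)).ne'
  have hd (u : EuclideanSpace ℝ (Fin n)) : HasDerivAt ξ (deriv ξ ‖x‖) ‖x + (0 : ℝ) • u‖ := by
    simpa using hasDerivAt_warping hξ ‖x‖
  have hdd (u : EuclideanSpace ℝ (Fin n)) :
      HasDerivAt (deriv ξ) (deriv (deriv ξ) ‖x‖) ‖x + (0 : ℝ) • u‖ := by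
    simpa using hasDerivAt_deriv_warping hξ ‖x‖
  have hline (u : EuclideanSpace ℝ (Fin n)) : HasDerivAt (fun h : ℝ => x + h • u) u 0 := by
    simpa using ((hasDerivAt_id (0 : ℝ)).smul_const u).const_add x
  have hn := hasDerivAt_norm_line hx x
  have e1 := ((hasDerivAt_const (0 : ℝ) (1 : ℝ)).div (hn.pow 2) (by simpa using hx)).sub
    (((((hd x).comp 0 hn).mul ((hdd x).comp 0 hn))).div (hn.pow 3) (by simpa using hx))
  have e2 := ((e1.mul_const (‖v‖ ^ 2)).smul (hline x)).congr_of_eventuallyEq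
    (f₁ := fun h : ℝ => christoffel (rotMetric n ξ) (x + h • x) v v) (by
      filter_upwards [eventually_line_ne_zero hx x] with h hh
      rw [christoffel_rotMetric hξ hh]
      simp [rotChristoffel, inner_add_left, real_inner_smul_left, hxv])
  rw [lineDeriv, e2.deriv]
  simp
  rw [← add_smul]
  congr 1
  field_simp
  ring

/-- The derivative `∂_v Γ(x, v)` for `v ⊥ x`: moving orthogonally to `x`, the norm is constant to
first order. -/
theorem lineDeriv_christoffel_tangential (hξ : IsWarpingFunction ξ)
    {x v : EuclideanSpace ℝ (Fin n)} (hx : x ≠ 0) (hxv : inner ℝ x v = 0) :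
    lineDeriv ℝ (fun y => christoffel (rotMetric n ξ) y x v) x v =
    (-‖v‖ ^ 2 * ((deriv ξ ‖x‖ / ξ ‖x‖ - 1 / ‖x‖) / ‖x‖
      + (1 / ‖x‖ ^ 2 - ξ ‖x‖ * deriv ξ ‖x‖ / ‖x‖ ^ 3))) • x := by
  have hρ : ‖x‖ ≠ 0 := norm_ne_zero_iff.2 hx
  have hξ0 : ξ ‖x‖ ≠ 0 := (hξ.pos _ (norm_pos_iff.2 hx)).ne'
  have hvx : inner ℝ v x = 0 := by rw [real_inner_comm, hxv]
  have hd (u : EuclideanSpace ℝ (Fin n)) : HasDerivAt ξ (deriv ξ ‖x‖) ‖x + (0 : ℝ) • u‖ := by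
    simpa using hasDerivAt_warping hξ ‖x‖
  have hdd (u : EuclideanSpace ℝ (Fin n)) :
      HasDerivAt (deriv ξ) (deriv (deriv ξ) ‖x‖) ‖x + (0 : ℝ) • u‖ := by
    simpa using hasDerivAt_deriv_warping hξ ‖x‖
  have hline (u : EuclideanSpace ℝ (Fin n)) : HasDerivAt (fun h : ℝ => x + h • u) u 0 := by
    simpa using ((hasDerivAt_id (0 : ℝ)).smul_const u).const_add x
  have hn := hasDerivAt_norm_line hx v
  rw [hxv, zero_div] at hn
  have ha := (((((hdd v).comp 0 hn)).div ((hd v).comp 0 hn) (by simpa using hξ0)).sub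
    ((hasDerivAt_const (0 : ℝ) (1 : ℝ)).div hn (by simpa using hx))).div hn (by simpa using hx)
  have hD := ((hasDerivAt_const (0 : ℝ) (1 : ℝ)).div (hn.pow 2) (by simpa using hx)).sub
    (((((hd v).comp 0 hn).mul ((hdd v).comp 0 hn))).div (hn.pow 3) (by simpa using hx))
  have hix := hasDerivAt_inner_line x v x
  have hiv := hasDerivAt_inner_line x v v
  have e2 := ((ha.smul ((hix.smul_const v).add (hiv.smul_const x))).add
    (((hD.mul_const (inner ℝ x v)).sub
      ((((ha.const_mul 2).add hD).div (hn.pow 2) (by simpa using hx)).mul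
        (hix.mul hiv))).smul (hline v))).congr_of_eventuallyEq
    (f₁ := fun h : ℝ => christoffel (rotMetric n ξ) (x + h • v) x v) (by
      filter_upwards [eventually_line_ne_zero hx v] with h hh
      rw [christoffel_rotMetric hξ hh]
      rfl)
  rw [lineDeriv, e2.deriv]
  simp [hxv, hvx]
  rw [smul_smul, ← neg_smul, ← neg_smul, ← add_smul]
  congr 1
  field_simp
  ring

/-- The curvature of a plane containing the radial direction is `-ξ'' / ξ`. -/
theorem sectionalCurvature_radial (hξ : IsWarpingFunction ξ) {x v : EuclideanSpace ℝ (Fin n)}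
    (hx : x ≠ 0) (hv : v ≠ 0) (hxv : inner ℝ x v = 0) :
    sectionalCurvature (rotMetric n ξ) x x v = -(deriv (deriv ξ) ‖x‖ / ξ ‖x‖) := by
  have hρ : ‖x‖ ≠ 0 := norm_ne_zero_iff.2 hx
  have hρv : ‖v‖ ≠ 0 := norm_ne_zero_iff.2 hv
  have hξ0 : ξ ‖x‖ ≠ 0 := (hξ.pos _ (norm_pos_iff.2 hx)).ne'
  have hvx : inner ℝ v x = 0 := by rw [real_inner_comm, hxv]
  have h3 : christoffel (rotMetric n ξ) x x v =
      ((deriv ξ ‖x‖ / ξ ‖x‖ - 1 / ‖x‖) * ‖x‖) • v := by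
    rw [christoffel_rotMetric hξ hx]
    simp only [rotChristoffel, hxv, real_inner_self_eq_norm_sq, zero_smul, mul_zero, sub_zero,
      add_zero, smul_smul]
    congr 1
    field_simp
  have h4 : christoffel (rotMetric n ξ) x v v =
      ((1 / ‖x‖ ^ 2 - ξ ‖x‖ * deriv ξ ‖x‖ / ‖x‖ ^ 3) * ‖v‖ ^ 2) • x := by
    rw [christoffel_rotMetric hξ hx]
    simp [rotChristoffel, hxv]
  have h5 (a : ℝ) : christoffel (rotMetric n ξ) x x (a • x) = 0 := by
    rw [christoffel_rotMetric hξ hx]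
    simp only [rotChristoffel, real_inner_self_eq_norm_sq, inner_smul_right, smul_smul,
      ← add_smul]
    convert zero_smul ℝ x using 2
    field_simp
    ring
  have h6 (a : ℝ) : christoffel (rotMetric n ξ) x v (a • v) =
      (a * ((1 / ‖x‖ ^ 2 - ξ ‖x‖ * deriv ξ ‖x‖ / ‖x‖ ^ 3) * ‖v‖ ^ 2)) • x := by
    rw [christoffel_rotMetric hξ hx]
    simp only [rotChristoffel, hxv, real_inner_self_eq_norm_sq, inner_smul_right, mul_zero,
      zero_smul, smul_zero, add_zero, zero_add, sub_zero]
    congr 1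
    ring
  have hR : riemannCurvature (rotMetric n ξ) x x v v =
      (-(‖v‖ ^ 2 * ξ ‖x‖ * deriv (deriv ξ) ‖x‖ / ‖x‖ ^ 2)) • x := by
    rw [riemannCurvature, lineDeriv_christoffel_radial hξ hx hxv,
      lineDeriv_christoffel_tangential hξ hx hxv, h4, h5, h3, h6, add_zero, ← add_smul, ← sub_smul]
    congr 1
    field_simp
    ring
  rw [sectionalCurvature, hR, rotMetric_of_ne hx, rotMetric_of_ne hx, rotMetric_of_ne hx,
    rotMetric_of_ne hx]
  simp only [hxv, real_inner_self_eq_norm_sq, inner_smul_left, inner_smul_right]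
  simp
  field_simp
  ring

end Metric

/-! ### The soliton equation of the profile curve -/

section Soliton

variable {n : ℕ} {ξ : ℝ → ℝ}

theorem rotMetric_smul_unit {ϑ : EuclideanSpace ℝ (Fin n)} (hϑ : ‖ϑ‖ = 1) {ρ : ℝ} (hρ : 0 < ρ)
    (v w : EuclideanSpace ℝ (Fin n)) :
    rotMetric n ξ (ρ • ϑ) v w = inner ℝ ϑ v * inner ℝ ϑ w
      + ξ ρ ^ 2 / ρ ^ 2 * (inner ℝ v w - inner ℝ ϑ v * inner ℝ ϑ w) := by
  have h0 : ρ • ϑ ≠ 0 := by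
    rw [← norm_ne_zero_iff, norm_smul, hϑ]
    simpa using hρ.ne'
  rw [rotMetric_of_ne h0, norm_smul, hϑ, Real.norm_of_nonneg hρ.le]
  simp only [real_inner_smul_left, mul_one]
  field_simp

/-- The velocity of the meridian through the point with parameters `(s, ϑ)`. -/
theorem deriv_meridian {r t : ℝ → ℝ} (hr : ContDiff ℝ 2 r) (ht : ContDiff ℝ 2 t) (s : ℝ)
    (ϑ : EuclideanSpace ℝ (Fin n)) :
    deriv (rotMap r t ∘ fun h => (s + h, ϑ)) =
      fun h => (deriv t (s + h), deriv r (s + h) • ϑ) := by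
  funext h
  have h1 : HasDerivAt (fun h => t (s + h)) (deriv t (s + h)) h :=
    (contDiff_two_hasDerivAt ht (s + h)).comp_const_add s h
  have h2 : HasDerivAt (fun h => r (s + h)) (deriv r (s + h)) h :=
    (contDiff_two_hasDerivAt hr (s + h)).comp_const_add s h
  exact (h1.prodMk (h2.smul_const ϑ)).deriv

theorem deriv_deriv_meridian {r t : ℝ → ℝ} (hr : ContDiff ℝ 2 r) (ht : ContDiff ℝ 2 t) (s : ℝ)
    (ϑ : EuclideanSpace ℝ (Fin n)) :
    deriv (deriv (rotMap r t ∘ fun h => (s + h, ϑ))) 0 =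
      (deriv (deriv t) s, deriv (deriv r) s • ϑ) := by
  rw [deriv_meridian hr ht]
  have h1 : HasDerivAt (fun h => deriv t (s + h)) (deriv (deriv t) s) 0 := by
    simpa using HasDerivAt.comp_const_add s 0
      (by simpa using contDiff_two_hasDerivAt_deriv ht s)
  have h2 : HasDerivAt (fun h => deriv r (s + h)) (deriv (deriv r) s) 0 := by
    simpa using HasDerivAt.comp_const_add s 0
      (by simpa using contDiff_two_hasDerivAt_deriv hr s)
  exact (h1.prodMk (h2.smul_const ϑ)).deriv

/-- The velocity of a parallel: a great circle of directions `ϑ`, run at the speed `1 / a`. -/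
theorem deriv_parallel (r t : ℝ → ℝ) (s a : ℝ) (ϑ e : EuclideanSpace ℝ (Fin n)) :
    deriv (rotMap r t ∘ fun h => (s, Real.cos (h / a) • ϑ + Real.sin (h / a) • e)) =
      fun h => (0, r s • ((-Real.sin (h / a) * (1 / a)) • ϑ + (Real.cos (h / a) * (1 / a)) • e)) := by
  funext h
  have h0 : HasDerivAt (fun h : ℝ => h / a) (1 / a) h := (hasDerivAt_id h).div_const a
  exact ((hasDerivAt_const h (t s)).prodMk
    (((h0.cos.smul_const ϑ).add (h0.sin.smul_const e)).const_smul (r s))).deriv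

theorem deriv_deriv_parallel (r t : ℝ → ℝ) (s a : ℝ) (ϑ e : EuclideanSpace ℝ (Fin n)) :
    deriv (deriv (rotMap r t ∘ fun h => (s, Real.cos (h / a) • ϑ + Real.sin (h / a) • e))) 0 =
      (0, (-(r s / a ^ 2)) • ϑ) := by
  rw [deriv_parallel]
  have h0 : HasDerivAt (fun h : ℝ => h / a) (1 / a) 0 := (hasDerivAt_id 0).div_const a
  have := ((hasDerivAt_const (0 : ℝ) (0 : ℝ)).prodMk
    ((((h0.sin.neg.mul_const (1 / a)).smul_const ϑ).add
      ((h0.cos.mul_const (1 / a)).smul_const e)).const_smul (r s))).deriv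
  refine this.trans ?_
  simp only [neg_zero, zero_smul, zero_div, Real.cos_zero, Real.sin_zero, zero_mul,
    add_zero, smul_smul, one_mul]
  congr 2
  field_simp

/-- The soliton equation for the profile curve: the first two terms are the curvature of the
meridian, and each of the `n - 1` parallel directions contributes the curvature
`(ξ' / ξ) ṫ`. -/
theorem profile_equation (hn : 2 ≤ n) (hξ : IsWarpingFunction ξ) {c : ℝ} {r t : ℝ → ℝ}
    (hr : ContDiff ℝ 2 r) (ht : ContDiff ℝ 2 t) (harc : ∀ s, deriv r s ^ 2 + deriv t s ^ 2 = 1)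
    (hsol : IsTranslatingSoliton (prodMetric (rotMetric n ξ)) (1, 0) c n (rotParam n) (rotMap r t))
    {s : ℝ} (hs : 0 < r s) :
    deriv (deriv t) s * deriv r s - deriv (deriv r) s * deriv t s
      + ((n : ℝ) - 1) * (deriv ξ (r s) / ξ (r s)) * deriv t s = c * deriv r s := by
  have hξ0 : ξ (r s) ≠ 0 := (hξ.pos _ hs).ne'
  set i₀ : Fin n := ⟨0, by omega⟩ with hi₀
  set e : Fin n → EuclideanSpace ℝ (Fin n) := fun i => EuclideanSpace.single i 1 with he
  have hee (i j : Fin n) : inner ℝ (e i) (e j) = if i = j then (1 : ℝ) else 0 := by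
    have := orthonormal_iff_ite.1 (EuclideanSpace.basisFun (Fin n) ℝ).orthonormal i j
    simpa [he] using this
  set ϑ := e i₀ with hϑ
  have hϑ1 : ‖ϑ‖ = 1 := by simp [hϑ, he]
  have hx0 : r s • ϑ ≠ 0 := by
    rw [← norm_ne_zero_iff, norm_smul, hϑ1]
    simpa using hs.ne'
  have hnx : ‖r s • ϑ‖ = r s := by rw [norm_smul, hϑ1, Real.norm_of_nonneg hs.le, mul_one]
  -- the speed `1 / ξ(r)` on the unit sphere gives the parallels unit speed in `g₀`
  set γ : Fin n → ℝ → ℝ × EuclideanSpace ℝ (Fin n) := fun i =>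
    if i = i₀ then fun h => (s + h, ϑ) else fun h =>
      (s, Real.cos (h / ξ (r s)) • ϑ + Real.sin (h / ξ (r s)) • e i) with hγ
  have hp : rotMap r t (s, ϑ) = (t s, r s • ϑ) := rfl
  have hd (i : Fin n) : deriv (rotMap r t ∘ γ i) 0 =
      if i = i₀ then (deriv t s, deriv r s • ϑ) else (0, (r s / ξ (r s)) • e i) := by
    by_cases hi : i = i₀
    · simp only [hγ, hi, if_true]
      rw [deriv_meridian hr ht]
      simp
    · simp only [hγ, hi, if_false]
      rw [deriv_parallel]
      simp [smul_smul, div_eq_mul_inv]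
  -- the unit normal `N = (ṙ, -ṫ ϑ)`
  have key := hsol (s, ϑ) hϑ1 (deriv r s, -deriv t s • ϑ) ?_ γ ?_ ?_ ?_
  · have hterm (i : Fin n) : prodMetric (rotMetric n ξ) (rotMap r t (s, ϑ))
        (covAccel (prodMetric (rotMetric n ξ)) (rotMap r t ∘ γ i)) (deriv r s, -deriv t s • ϑ) =
        if i = i₀ then deriv (deriv t) s * deriv r s - deriv (deriv r) s * deriv t s
        else deriv ξ (r s) / ξ (r s) * deriv t s := by
      by_cases hi : i = i₀
      · have hγi : γ i = fun h => (s + h, ϑ) := by simp [hγ, hi]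
        have h0 : (rotMap r t ∘ γ i) 0 = (t s, r s • ϑ) := by simp [hγi, rotMap]
        rw [covAccel, h0, hd, christoffel_prodMetric hξ hx0, hγi, deriv_deriv_meridian hr ht]
        simp only [hi, if_true, hp, prodMetric, rotChristoffel, hnx, Prod.fst_add, Prod.snd_add]
        rw [rotMetric_smul_unit hϑ1 hs]
        simp only [inner_add_right, inner_add_left, real_inner_smul_left, real_inner_smul_right,
          real_inner_self_eq_norm_sq, hϑ1, norm_smul, mul_pow, Real.norm_eq_abs, sq_abs]
        field_simp
        ring
      · have hγi : γ i = fun h =>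
            (s, Real.cos (h / ξ (r s)) • ϑ + Real.sin (h / ξ (r s)) • e i) := by simp [hγ, hi]
        have h0 : (rotMap r t ∘ γ i) 0 = (t s, r s • ϑ) := by simp [hγi, rotMap]
        have hei : inner ℝ ϑ (e i) = (0 : ℝ) := by rw [hϑ, hee, if_neg (Ne.symm hi)]
        have hie : inner ℝ (e i) ϑ = (0 : ℝ) := by rw [hϑ, hee, if_neg hi]
        have hii : ‖e i‖ = 1 := by simp [he]
        rw [covAccel, h0, hd, christoffel_prodMetric hξ hx0, hγi, deriv_deriv_parallel]
        simp only [hi, if_false, hp, prodMetric, rotChristoffel, hnx, Prod.fst_add, Prod.snd_add]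
        rw [rotMetric_smul_unit hϑ1 hs]
        simp only [inner_add_right, inner_add_left, real_inner_smul_left, real_inner_smul_right,
          real_inner_self_eq_norm_sq, hϑ1, hei, hie, hii, norm_smul, mul_pow, Real.norm_eq_abs, sq_abs]
        field_simp
        ring
    simp only [hterm] at key
    rw [← Finset.add_sum_erase _ _ (Finset.mem_univ i₀), if_pos rfl,
      Finset.sum_congr rfl (fun i hi => if_neg (Finset.ne_of_mem_erase hi))] at key
    rw [Finset.sum_const, Finset.card_erase_of_mem (Finset.mem_univ _), Finset.card_univ,
      Fintype.card_fin, nsmul_eq_mul, Nat.cast_sub (by omega), Nat.cast_one, hp] at key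
    have h0 : rotMetric n ξ (r s • ϑ) 0 (-deriv t s • ϑ) = 0 := by
      rw [rotMetric_smul_unit hϑ1 hs]; simp
    simp only [prodMetric, h0, one_mul, add_zero] at key
    linarith
  · rw [hp, prodMetric, rotMetric_smul_unit hϑ1 hs]
    simp only [real_inner_smul_right, real_inner_self_eq_norm_sq, hϑ1, norm_smul, mul_pow, Real.norm_eq_abs, sq_abs]
    linear_combination harc s
  · intro i
    by_cases hi : i = i₀
    · have hγi : γ i = fun h => (s + h, ϑ) := by simp [hγ, hi]
      rw [hγi]
      exact ⟨by fun_prop, fun h => hϑ1, by simp⟩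
    · have hγi : γ i = fun h =>
          (s, Real.cos (h / ξ (r s)) • ϑ + Real.sin (h / ξ (r s)) • e i) := by simp [hγ, hi]
      have hei : inner ℝ ϑ (e i) = (0 : ℝ) := by rw [hϑ, hee, if_neg (Ne.symm hi)]
      have hii : ‖e i‖ = 1 := by simp [he]
      rw [hγi]
      refine ⟨?_, fun h => ?_, by simp⟩
      · have h1 : ContDiff ℝ 2 fun h : ℝ => h / ξ (r s) := contDiff_id.div_const _
        exact contDiff_const.prodMk (((h1.cos).smul contDiff_const).add
          ((h1.sin).smul contDiff_const))
      · have h2 : ‖Real.cos (h / ξ (r s)) • ϑ + Real.sin (h / ξ (r s)) • e i‖ ^ 2 = 1 := by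
          rw [norm_add_sq_real, norm_smul, norm_smul, real_inner_smul_left, real_inner_smul_right,
            hei, hϑ1, hii, mul_pow, mul_pow, Real.norm_eq_abs, Real.norm_eq_abs, sq_abs, sq_abs]
          linear_combination Real.cos_sq_add_sin_sq (h / ξ (r s))
        exact (pow_eq_one_iff_of_nonneg (norm_nonneg _) two_ne_zero).1 h2
  · intro i j
    rw [hd, hd, hp, prodMetric, rotMetric_smul_unit hϑ1 hs]
    by_cases hi : i = i₀ <;> by_cases hj : j = i₀
    · simp only [hi, hj, if_true, real_inner_smul_right,
        real_inner_self_eq_norm_sq, hϑ1, norm_smul, mul_pow, Real.norm_eq_abs, sq_abs]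
      linear_combination harc s
    · simp [hi, hj, Ne.symm hj, hϑ, hee, real_inner_smul_left, real_inner_smul_right]
    · simp [hi, hj, hϑ, hee, real_inner_smul_left, real_inner_smul_right, Ne.symm hi]
    · simp only [hi, hj, if_false, hϑ, hee, real_inner_smul_left, real_inner_smul_right,
        Ne.symm hi, Ne.symm hj]
      by_cases hij : i = j
      · simp only [hij, if_true]; field_simp; ring
      · simp [hij]
  · intro i
    rw [hd, hp, prodMetric, rotMetric_smul_unit hϑ1 hs]
    by_cases hi : i = i₀
    · simp only [hi, if_true, real_inner_smul_left, real_inner_smul_right,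
        real_inner_self_eq_norm_sq, hϑ1]
      ring
    · simp [hi, hϑ, hee, real_inner_smul_left, real_inner_smul_right, Ne.symm hi]

end Soliton

/-! ### Consequences of the curvature bound -/

section Warping

variable {n : ℕ} {ξ : ℝ → ℝ}

/-- The curvature bound, applied to a plane containing the radial direction. -/
theorem warping_second_deriv_ge (hn : 2 ≤ n) (hξ : IsWarpingFunction ξ) {K : ℝ}
    (hK : ∀ x u v : EuclideanSpace ℝ (Fin n), LinearIndependent ℝ ![u, v] →
      sectionalCurvature (rotMetric n ξ) x u v ≤ K) {ρ : ℝ} (hρ : 0 < ρ) :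
    -K * ξ ρ ≤ deriv (deriv ξ) ρ := by
  set i₀ : Fin n := ⟨0, by omega⟩
  set i₁ : Fin n := ⟨1, by omega⟩
  have hne : i₀ ≠ i₁ := by simp [i₀, i₁]
  set x : EuclideanSpace ℝ (Fin n) := ρ • EuclideanSpace.single i₀ 1 with hx
  set v : EuclideanSpace ℝ (Fin n) := EuclideanSpace.single i₁ 1 with hv
  have hxn : ‖x‖ = ρ := by simp [hx, norm_smul, abs_of_pos hρ]
  have hx0 : x ≠ 0 := by rw [← norm_ne_zero_iff, hxn]; exact hρ.ne'
  have hv0 : v ≠ 0 := by rw [← norm_ne_zero_iff]; simp [hv]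
  have hxv : inner ℝ x v = (0 : ℝ) := by
    have := (EuclideanSpace.basisFun (Fin n) ℝ).orthonormal.2 hne
    rw [hx, real_inner_smul_left]
    simpa [hv] using Or.inr this
  have hli : LinearIndependent ℝ ![x, v] := by
    refine linearIndependent_of_ne_zero_of_inner_eq_zero (𝕜 := ℝ) ?_ ?_
    · intro i; fin_cases i <;> simp [hx0, hv0]
    · intro i j hij
      fin_cases i <;> fin_cases j <;> simp_all [real_inner_comm]
  have h := hK x x v hli
  rw [sectionalCurvature_radial hξ hx0 hv0 hxv, hxn] at h
  have := hξ.pos ρ hρ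
  have h2 : -K ≤ deriv (deriv ξ) ρ / ξ ρ := by linarith
  exact (le_div_iff₀ this).1 h2

theorem one_le_deriv_warping (hξ : IsWarpingFunction ξ) {k : ℝ} (hk : 0 < k)
    (h2 : ∀ ρ, 0 < ρ → k * ξ ρ ≤ deriv (deriv ξ) ρ) {ρ : ℝ} (hρ : 0 ≤ ρ) :
    1 ≤ deriv ξ ρ := by
  have hmono : MonotoneOn (deriv ξ) (Set.Ici 0) := by
    refine monotoneOn_of_deriv_nonneg (convex_Ici 0) ?_ ?_ ?_
    · exact fun x _ => (hasDerivAt_deriv_warping hξ x).continuousAt.continuousWithinAt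
    · exact fun x _ => (hasDerivAt_deriv_warping hξ x).differentiableAt.differentiableWithinAt
    · intro x hx
      rw [interior_Ici] at hx
      exact (mul_pos hk (hξ.pos x hx)).le.trans (h2 x hx)
  rw [← hξ.deriv_zero]
  exact hmono Set.self_mem_Ici hρ hρ

/-- If `ξ'' ≥ k ξ`, then `ξ'² - k ξ²` is nondecreasing, so `ξ' / ξ ≥ √k`. -/
theorem sqrt_le_log_deriv_warping (hξ : IsWarpingFunction ξ) {k : ℝ} (hk : 0 < k)
    (h2 : ∀ ρ, 0 < ρ → k * ξ ρ ≤ deriv (deriv ξ) ρ) {ρ : ℝ} (hρ : 0 < ρ) :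
    √k ≤ deriv ξ ρ / ξ ρ := by
  have hd (x : ℝ) : HasDerivAt (fun x => deriv ξ x ^ 2 - k * ξ x ^ 2)
      (2 * deriv ξ x * (deriv (deriv ξ) x - k * ξ x)) x := by
    have := ((hasDerivAt_deriv_warping hξ x).pow 2).sub
      (((hasDerivAt_warping hξ x).pow 2).const_mul k)
    refine this.congr_deriv ?_
    simp
    ring
  have hmono : MonotoneOn (fun x => deriv ξ x ^ 2 - k * ξ x ^ 2) (Set.Ici 0) := by
    refine monotoneOn_of_deriv_nonneg (convex_Ici 0) ?_ ?_ ?_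
    · exact fun x _ => (hd x).continuousAt.continuousWithinAt
    · exact fun x _ => (hd x).differentiableAt.differentiableWithinAt
    · intro x hx
      rw [interior_Ici] at hx
      rw [(hd x).deriv]
      have h1 := one_le_deriv_warping hξ hk h2 (le_of_lt hx)
      have h3 := h2 x hx
      exact mul_nonneg (by linarith) (by linarith)
  have h0 : ξ 0 = 0 := by have := hξ.odd 0; rw [neg_zero] at this; linarith
  have h1 := hmono Set.self_mem_Ici hρ.le hρ.le
  have h3 := one_le_deriv_warping hξ hk h2 hρ.le
  have h4 := hξ.pos ρ hρ
  simp only [h0, hξ.deriv_zero] at h1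
  rw [le_div_iff₀ h4]
  refine abs_le_of_sq_le_sq' ?_ (by linarith) |>.2
  rw [mul_pow, Real.sq_sqrt hk.le]
  linarith

end Warping

/-! ### Profile curves -/

/-- A curve `s ↦ (r(s), t(s))` parametrized by arc length and satisfying, off the axis, the soliton
equation `ẗ ṙ - r̈ ṫ + m q(r) ṫ = c ṙ`; for the metric `dr² + ξ² dϑ²` on `ℝⁿ`, `m = n - 1` and
`q = ξ' / ξ`. -/
structure IsProfile (c m : ℝ) (q r t : ℝ → ℝ) : Prop where
  contDiff_r : ContDiff ℝ 2 r
  contDiff_t : ContDiff ℝ 2 t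
  arclength : ∀ s, deriv r s ^ 2 + deriv t s ^ 2 = 1
  equation : ∀ s, 0 < r s → deriv (deriv t) s * deriv r s - deriv (deriv r) s * deriv t s
      + m * q (r s) * deriv t s = c * deriv r s

/-- The part `s > 0` of the curve moves away from the axis. -/
structure IsOutgoing (r : ℝ → ℝ) : Prop where
  pos : ∀ s, 0 < s → 0 < r s
  deriv_pos : ∀ s, 0 < s → 0 < deriv r s

namespace IsProfile

variable {c m κ : ℝ} {q r t : ℝ → ℝ}

theorem hasDerivAt_r (h : IsProfile c m q r t) (s : ℝ) : HasDerivAt r (deriv r s) s :=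
  contDiff_two_hasDerivAt h.contDiff_r s

theorem hasDerivAt_t (h : IsProfile c m q r t) (s : ℝ) : HasDerivAt t (deriv t s) s :=
  contDiff_two_hasDerivAt h.contDiff_t s

theorem hasDerivAt_deriv_r (h : IsProfile c m q r t) (s : ℝ) :
    HasDerivAt (deriv r) (deriv (deriv r) s) s :=
  contDiff_two_hasDerivAt_deriv h.contDiff_r s

theorem hasDerivAt_deriv_t (h : IsProfile c m q r t) (s : ℝ) :
    HasDerivAt (deriv t) (deriv (deriv t) s) s :=
  contDiff_two_hasDerivAt_deriv h.contDiff_t s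

theorem reverse (h : IsProfile c m q r t) :
    IsProfile c m q (fun s => r (-s)) (fun s => t (-s)) := by
  have hd (f : ℝ → ℝ) : deriv (fun s => f (-s)) = fun s => -deriv f (-s) :=
    funext fun s => deriv_comp_neg f s
  have hdd (f : ℝ → ℝ) : deriv (deriv fun s => f (-s)) = fun s => deriv (deriv f) (-s) := by
    rw [hd]
    funext s
    rw [deriv.fun_neg, deriv_comp_neg, neg_neg]
  refine ⟨h.contDiff_r.comp contDiff_neg, h.contDiff_t.comp contDiff_neg, fun s => ?_,
    fun s hs => ?_⟩
  · simp only [hd]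
    linear_combination h.arclength (-s)
  · simp only [hdd]
    simp only [hd]
    linear_combination -h.equation (-s) hs

theorem velocity_orthogonal (h : IsProfile c m q r t) (s : ℝ) :
    deriv r s * deriv (deriv r) s + deriv t s * deriv (deriv t) s = 0 := by
  have h1 := ((h.hasDerivAt_deriv_r s).pow 2).add ((h.hasDerivAt_deriv_t s).pow 2)
  have h2 : (deriv r ^ 2 + deriv t ^ 2) = fun _ => (1 : ℝ) := funext h.arclength
  rw [h2] at h1
  have := h1.unique (hasDerivAt_const s (1 : ℝ))
  simp at this
  linarith

theorem second_deriv_r (h : IsProfile c m q r t) {s : ℝ} (hs : 0 < r s) :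
    deriv (deriv r) s = m * q (r s) * deriv t s ^ 2 - c * deriv r s * deriv t s := by
  linear_combination (-deriv (deriv r) s) * h.arclength s + deriv r s * h.velocity_orthogonal s
    - deriv t s * h.equation s hs

/-- At a point where the curve is vertical, `r̈ = m q(r) > 0`: so `ṙ` vanishes only while
increasing. -/
theorem second_deriv_r_pos (h : IsProfile c m q r t) (hm : 0 < m) (hq : ∀ ρ, 0 < ρ → 0 < q ρ)
    {s : ℝ} (hs : 0 < r s) (h0 : deriv r s = 0) : 0 < deriv (deriv r) s := by
  have h1 := h.arclength s
  rw [h.second_deriv_r hs, h0]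
  rw [h0] at h1
  have : deriv t s ^ 2 = 1 := by linarith
  rw [this]
  have := mul_pos hm (hq _ hs)
  linarith

theorem isOutgoing (h : IsProfile c m q r t) (hm : 0 < m) (hq : ∀ ρ, 0 < ρ → 0 < q ρ)
    (hpos : ∀ s, 0 < s → 0 < r s) (h0 : 0 ≤ deriv r 0) (h00 : deriv r 0 = 0 → 0 < r 0) :
    IsOutgoing r := by
  have hnn : ∀ s, 0 ≤ s → 0 ≤ deriv r s := by
    intro s hs
    refine image_le_of_deriv_right_lt_deriv_boundary (f := fun _ => 0) (f' := fun _ => 0)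
      (a := 0) (b := s) continuousOn_const (fun x _ => hasDerivWithinAt_const _ _ _) h0
      h.hasDerivAt_deriv_r (fun x hx hx0 => ?_) ⟨hs, le_rfl⟩
    refine h.second_deriv_r_pos hm hq ?_ hx0.symm
    rcases hx.1.eq_or_lt with rfl | hx1
    · exact h00 hx0.symm
    · exact hpos x hx1
  refine ⟨hpos, fun s hs => (hnn s hs.le).lt_of_ne fun hz => ?_⟩
  have hmin : IsLocalMin (deriv r) s := by
    filter_upwards [lt_mem_nhds hs] with x hx
    rw [← hz]
    exact hnn x hx.le
  exact (h.second_deriv_r_pos hm hq (hpos s hs) hz.symm).ne' hmin.deriv_eq_zero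

/-- Once `ṙ` is small the curve is nearly vertical and bends away from the axis; so `ṙ` stays
bounded below. -/
theorem exists_le_deriv_r (h : IsProfile c m q r t) (ho : IsOutgoing r) (hm : 0 < m) (hκ : 0 < κ)
    (hq : ∀ ρ, 0 < ρ → κ ≤ q ρ) : ∃ δ, 0 < δ ∧ ∀ s, 1 ≤ s → δ ≤ deriv r s := by
  set δ := min (deriv r 1) (min (1 / 2) (m * κ / (4 * (|c| + 1)))) with hδ
  have hc : 0 < |c| + 1 := by positivity
  have hδ0 : 0 < δ := lt_min (ho.deriv_pos 1 one_pos) (lt_min (by norm_num) (by positivity))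
  refine ⟨δ, hδ0, fun s hs => ?_⟩
  refine image_le_of_deriv_right_lt_deriv_boundary (f := fun _ => δ) (f' := fun _ => 0)
    (a := 1) (b := s) continuousOn_const (fun x _ => hasDerivWithinAt_const _ _ _)
    (min_le_left _ _) h.hasDerivAt_deriv_r (fun x hx hx0 => ?_) ⟨hs, le_rfl⟩
  have hx1 : 0 < r x := ho.pos x (one_pos.trans_le hx.1)
  have hx0 : δ = deriv r x := hx0
  have e1 : δ ≤ 1 / 2 := (min_le_right _ _).trans (min_le_left _ _)
  have e2 : |c| * δ ≤ m * κ / 4 := by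
    have : δ ≤ m * κ / (4 * (|c| + 1)) := (min_le_right _ _).trans (min_le_right _ _)
    rw [le_div_iff₀ (by positivity)] at this
    nlinarith
  have e3 := h.arclength x
  rw [← hx0] at e3
  have e4 : 1 / 2 ≤ |deriv t x| := by
    have : (1 / 2 : ℝ) ^ 2 ≤ |deriv t x| ^ 2 := by rw [sq_abs]; nlinarith
    exact (abs_le_of_sq_le_sq' this (abs_nonneg _)).2
  have e5 : c * δ * deriv t x ≤ |c| * δ * |deriv t x| := by
    calc c * δ * deriv t x ≤ |c * δ * deriv t x| := le_abs_self _
      _ = |c| * δ * |deriv t x| := by rw [abs_mul, abs_mul, abs_of_pos hδ0]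
  have e6 : m * κ * |deriv t x| ^ 2 ≤ m * q (r x) * deriv t x ^ 2 := by
    rw [sq_abs]
    gcongr
    exact hq _ hx1
  have e7 : |c| * δ * |deriv t x| ≤ m * κ / 4 * |deriv t x| := by gcongr
  have e8 : 0 < m * κ * |deriv t x| * (|deriv t x| - 1 / 4) := by
    have : 0 < |deriv t x| - 1 / 4 := by linarith
    positivity
  rw [h.second_deriv_r hx1, ← hx0]
  nlinarith

theorem tendsto_r (h : IsProfile c m q r t) (ho : IsOutgoing r) (hm : 0 < m) (hκ : 0 < κ)
    (hq : ∀ ρ, 0 < ρ → κ ≤ q ρ) : Tendsto r atTop atTop := by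
  obtain ⟨δ, hδ, hle⟩ := h.exists_le_deriv_r ho hm hκ hq
  have hlin : Tendsto (fun s => δ * (s - 1) + r 1) atTop atTop :=
    tendsto_atTop_add_const_right _ _
      (Tendsto.const_mul_atTop hδ (tendsto_atTop_add_const_right _ (-1) tendsto_id))
  refine tendsto_atTop_mono' _ ?_ hlin
  filter_upwards [eventually_ge_atTop 1] with s hs
  have := (convex_Ici (1 : ℝ)).mul_sub_le_image_sub_of_le_deriv (f := r) (C := δ)
    (fun x _ => (h.hasDerivAt_r x).continuousAt.continuousWithinAt)
    (fun x _ => (h.hasDerivAt_r x).differentiableAt.differentiableWithinAt)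
    (fun x hx => hle x (interior_subset hx)) 1 Set.self_mem_Ici s hs hs
  linarith

theorem strictMonoOn_r (h : IsProfile c m q r t) (ho : IsOutgoing r) :
    StrictMonoOn r (Set.Ici 0) := by
  refine strictMonoOn_of_deriv_pos (convex_Ici 0)
    (fun x _ => (h.hasDerivAt_r x).continuousAt.continuousWithinAt) fun x hx => ?_
  rw [interior_Ici] at hx
  exact ho.deriv_pos x hx

/-- The slope `p = dt/dr = ṫ / ṙ` along an outgoing profile relaxes towards `c / (m q(r))`. -/
theorem hasDerivAt_slope (h : IsProfile c m q r t) (ho : IsOutgoing r) {s : ℝ} (hs : 0 < s) :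
    HasDerivAt (fun s => deriv t s / deriv r s)
      ((c - m * q (r s) * (deriv t s / deriv r s)) / deriv r s) s := by
  have hr := (ho.deriv_pos s hs).ne'
  refine ((h.hasDerivAt_deriv_t s).div (h.hasDerivAt_deriv_r s) hr).congr_deriv ?_
  field_simp
  linear_combination h.equation s (ho.pos s hs)

end IsProfile

/-! ### The radial graph function of an outgoing branch -/

/-- `σ` expresses the arc length parameter of the outgoing part of the curve as a function of the
distance to the axis. -/
structure IsRadialInverse (r σ : ℝ → ℝ) : Prop where
  pos : ∀ ρ, r 0 < ρ → 0 < σ ρ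
  right_inv : ∀ ρ, r 0 < ρ → r (σ ρ) = ρ
  left_inv : ∀ s, 0 < s → σ (r s) = s
  hasDerivAt : ∀ ρ, r 0 < ρ → HasDerivAt σ (deriv r (σ ρ))⁻¹ ρ
  tendsto : Tendsto σ atTop atTop

theorem IsProfile.exists_isRadialInverse {c m κ : ℝ} {q r t : ℝ → ℝ} (h : IsProfile c m q r t)
    (ho : IsOutgoing r) (hm : 0 < m) (hκ : 0 < κ) (hq : ∀ ρ, 0 < ρ → κ ≤ q ρ) :
    ∃ σ, IsRadialInverse r σ := by
  have hmono := h.strictMonoOn_r ho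
  have htop := h.tendsto_r ho hm hκ hq
  have hcont : Continuous r := h.contDiff_r.continuous
  have hlt {s : ℝ} (hs : 0 < s) : r 0 < r s := hmono Set.self_mem_Ici hs.le hs
  have hsurj : ∀ ρ, r 0 < ρ → ∃ s, 0 < s ∧ r s = ρ := by
    intro ρ hρ
    obtain ⟨b, hb, hb0⟩ := ((htop.eventually_ge_atTop ρ).and (eventually_ge_atTop 0)).exists
    obtain ⟨s, hs, rfl⟩ := intermediate_value_Icc hb0 hcont.continuousOn ⟨hρ.le, hb⟩
    refine ⟨s, hs.1.lt_of_ne ?_, rfl⟩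
    rintro rfl
    exact lt_irrefl _ hρ
  choose! σ hσ0 hσ using hsurj
  have hleft : ∀ s, 0 < s → σ (r s) = s := fun s hs =>
    hmono.injOn (hσ0 _ (hlt hs)).le hs.le (hσ _ (hlt hs))
  have hσmono : StrictMonoOn σ (Set.Ioi (r 0)) := by
    intro a ha b hb hab
    refine (hmono.lt_iff_lt (hσ0 a ha).le (hσ0 b hb).le).1 ?_
    rwa [hσ a ha, hσ b hb]
  have himage : σ '' Set.Ioi (r 0) = Set.Ioi 0 := by
    ext s
    constructor
    · rintro ⟨ρ, hρ, rfl⟩; exact hσ0 ρ hρ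
    · intro hs; exact ⟨r s, hlt hs, hleft s hs⟩
  refine ⟨σ, hσ0, hσ, hleft, fun ρ hρ => ?_, ?_⟩
  · have hc : ContinuousAt σ ρ := hσmono.continuousAt_of_image_mem_nhds (Ioi_mem_nhds hρ)
      (by rw [himage]; exact Ioi_mem_nhds (hσ0 ρ hρ))
    refine HasDerivAt.of_local_left_inverse hc (h.hasDerivAt_r _)
      (ho.deriv_pos _ (hσ0 ρ hρ)).ne' ?_
    filter_upwards [lt_mem_nhds hρ] with y hy using hσ y hy
  · refine tendsto_atTop.2 fun b => ?_
    have hb : 0 < max b 1 := lt_max_of_lt_right one_pos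
    filter_upwards [eventually_gt_atTop (r (max b 1))] with ρ hρ
    have hρ0 : r 0 < ρ := (hlt hb).trans hρ
    refine (le_max_left b 1).trans ((hmono.le_iff_le hb.le (hσ0 ρ hρ0).le).1 ?_)
    rw [hσ ρ hρ0]
    exact hρ.le

namespace IsRadialInverse

variable {c m : ℝ} {q r t σ : ℝ → ℝ}

theorem hasDerivAt_graph (hσ : IsRadialInverse r σ) (h : IsProfile c m q r t) {ρ : ℝ}
    (hρ : r 0 < ρ) :
    HasDerivAt (fun ρ => t (σ ρ)) (deriv t (σ ρ) / deriv r (σ ρ)) ρ := by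
  simpa [div_eq_mul_inv, Function.comp_def] using
    (h.hasDerivAt_t (σ ρ)).comp ρ (hσ.hasDerivAt ρ hρ)

/-- The slope of the radial graph solves `p' = (1 + p²) (c - m q p)`. -/
theorem hasDerivAt_slope (hσ : IsRadialInverse r σ) (h : IsProfile c m q r t) (ho : IsOutgoing r)
    {ρ : ℝ} (hρ : r 0 < ρ) :
    HasDerivAt (fun ρ => deriv t (σ ρ) / deriv r (σ ρ))
      ((1 + (deriv t (σ ρ) / deriv r (σ ρ)) ^ 2)
        * (c - m * q ρ * (deriv t (σ ρ) / deriv r (σ ρ)))) ρ := by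
  have hs := hσ.pos ρ hρ
  have hr := (ho.deriv_pos _ hs).ne'
  have h1 := (h.hasDerivAt_slope ho hs).comp ρ (hσ.hasDerivAt ρ hρ)
  refine h1.congr_deriv ?_
  rw [hσ.right_inv ρ hρ]
  field_simp
  rw [add_comm (deriv r (σ ρ) ^ 2), add_comm, h.arclength]
  ring

end IsRadialInverse

/-! ### Asymptotics of the slope -/

/-- Solutions of `w' = -a w + b` with `a ≥ a₀ > 0` and `b → 0` tend to `0`. -/
theorem tendsto_zero_of_forced_decay {w a b : ℝ → ℝ} {a₀ S : ℝ} (ha₀ : 0 < a₀)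
    (hw : ∀ s, S ≤ s → HasDerivAt w (-a s * w s + b s) s) (ha : ∀ s, S ≤ s → a₀ ≤ a s)
    (hb : Tendsto b atTop (𝓝 0)) : Tendsto w atTop (𝓝 0) := by
  -- `(w²)' ≤ -a₀ w² + b² / a₀`, so `(w² - η) exp (a₀ s)` is eventually nonincreasing
  suffices hsq : ∀ η : ℝ, 0 < η → ∀ᶠ s in atTop, w s ^ 2 < 2 * η by
    have : Tendsto (fun s => w s ^ 2) atTop (𝓝 0) := by
      refine (tendsto_order.2 ⟨fun x hx => ?_, fun x hx => ?_⟩)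
      · exact Eventually.of_forall fun s => hx.trans_le (sq_nonneg _)
      · filter_upwards [hsq (x / 2) (by positivity)] with s hs
        linarith
    have h2 := (Real.continuous_sqrt.tendsto 0).comp this
    rw [Real.sqrt_zero] at h2
    refine (tendsto_zero_iff_abs_tendsto_zero _).2 (h2.congr fun s => ?_)
    simp [Real.sqrt_sq_eq_abs]
  intro η hη
  have hb2 : ∀ᶠ s in atTop, b s ^ 2 < a₀ ^ 2 * η := by
    have : Tendsto (fun s => b s ^ 2) atTop (𝓝 0) := by simpa using hb.pow 2
    exact this.eventually_lt_const (by positivity)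
  obtain ⟨T, hT⟩ := eventually_atTop.1 (hb2.and (eventually_ge_atTop S))
  have hd (s : ℝ) (hs : T ≤ s) : HasDerivAt (fun s => (w s ^ 2 - η) * Real.exp (a₀ * s))
      ((2 * w s * (-a s * w s + b s) + a₀ * (w s ^ 2 - η)) * Real.exp (a₀ * s)) s := by
    have h1 := ((hw s (hT s hs).2).pow 2).sub_const η
    have h2 : HasDerivAt (fun s => Real.exp (a₀ * s)) (Real.exp (a₀ * s) * a₀) s := by
      simpa using ((hasDerivAt_id s).const_mul a₀).exp
    refine (h1.mul h2).congr_deriv ?_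
    simp
    ring
  have hanti : AntitoneOn (fun s => (w s ^ 2 - η) * Real.exp (a₀ * s)) (Set.Ici T) := by
    refine antitoneOn_of_deriv_nonpos (convex_Ici T)
      (fun x hx => (hd x hx).continuousAt.continuousWithinAt)
      (fun x hx => (hd x (interior_subset hx)).differentiableAt.differentiableWithinAt)
      fun x hx => ?_
    have hx : T ≤ x := interior_subset hx
    rw [(hd x hx).deriv]
    refine mul_nonpos_of_nonpos_of_nonneg ?_ (Real.exp_pos _).le
    have h1 := (hT x hx).1
    have h2 : a₀ * w x ^ 2 ≤ a x * w x ^ 2 :=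
      mul_le_mul_of_nonneg_right (ha x (hT x hx).2) (sq_nonneg _)
    have h3 : a₀ * (2 * w x * b x - a₀ * w x ^ 2 - a₀ * η) ≤ 0 := by
      nlinarith [sq_nonneg (a₀ * w x - b x)]
    have h4 := nonpos_of_mul_nonpos_right h3 ha₀
    nlinarith
  have hexp : Tendsto (fun s => (w T ^ 2 - η) * Real.exp (a₀ * T) * Real.exp (-(a₀ * s))) atTop
      (𝓝 0) := by
    have : Tendsto (fun s => Real.exp (-(a₀ * s))) atTop (𝓝 0) :=
      Real.tendsto_exp_neg_atTop_nhds_zero.comp (tendsto_id.const_mul_atTop ha₀)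
    simpa using this.const_mul ((w T ^ 2 - η) * Real.exp (a₀ * T))
  filter_upwards [hexp.eventually_lt_const hη, eventually_ge_atTop T] with s hs hsT
  have h1 := hanti Set.self_mem_Ici hsT hsT
  have h2 : w s ^ 2 - η ≤ (w T ^ 2 - η) * Real.exp (a₀ * T) * Real.exp (-(a₀ * s)) := by
    rw [Real.exp_neg, ← div_eq_mul_inv, le_div_iff₀ (Real.exp_pos _)]
    exact h1
  linarith

/-- The slope approaches the moving equilibrium `(c / m) P`, `P = 1 / q`, of its equation, because
`P' → 0`. -/
theorem IsProfile.tendsto_slope_sub {c m κ : ℝ} {q P r t : ℝ → ℝ} (h : IsProfile c m q r t)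
    (ho : IsOutgoing r) (hm : 0 < m) (hκ : 0 < κ) (hq : ∀ ρ, 0 < ρ → κ ≤ q ρ)
    (hP : ∀ ρ, 0 < ρ → DifferentiableAt ℝ P ρ) (hqP : ∀ ρ, 0 < ρ → q ρ * P ρ = 1)
    (hlim : Tendsto (deriv P) atTop (𝓝 0)) :
    Tendsto (fun s => deriv t s / deriv r s - c / m * P (r s)) atTop (𝓝 0) := by
  have hr1 (s : ℝ) : deriv r s ≤ 1 := by
    have := h.arclength s
    nlinarith [sq_nonneg (deriv t s), sq_nonneg (deriv r s - 1)]
  refine tendsto_zero_of_forced_decay (a := fun s => m * q (r s) / deriv r s)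
    (b := fun s => -(c / m * (deriv P (r s) * deriv r s))) (a₀ := m * κ) (S := 1) (by positivity)
    (fun s hs => ?_) (fun s hs => ?_) ?_
  · have hs0 : 0 < s := one_pos.trans_le hs
    have hr := (ho.deriv_pos s hs0).ne'
    have h1 := (h.hasDerivAt_slope ho hs0).sub
      ((((hP _ (ho.pos s hs0)).hasDerivAt.comp s (h.hasDerivAt_r s))).const_mul (c / m))
    refine h1.congr_deriv ?_
    have h2 := hqP _ (ho.pos s hs0)
    field_simp
    linear_combination (-m * c * deriv r s) * h2
  · have hs0 : 0 < s := one_pos.trans_le hs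
    rw [le_div_iff₀ (ho.deriv_pos s hs0)]
    calc m * κ * deriv r s ≤ m * κ * 1 := by
          have := hr1 s
          gcongr
      _ = m * κ := mul_one _
      _ ≤ m * q (r s) := by
          have := hq _ (ho.pos s hs0)
          gcongr
  · have h1 : Tendsto (fun s => deriv P (r s)) atTop (𝓝 0) :=
      hlim.comp (h.tendsto_r ho hm hκ hq)
    have h2 : Tendsto (fun s => deriv P (r s) * deriv r s) atTop (𝓝 0) := by
      refine squeeze_zero_norm' ?_ (tendsto_zero_iff_abs_tendsto_zero _ |>.1 h1)
      filter_upwards [eventually_gt_atTop 0] with s hs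
      rw [norm_mul, Real.norm_eq_abs, Real.norm_eq_abs, abs_of_pos (ho.deriv_pos s hs)]
      exact mul_le_of_le_one_right (abs_nonneg _) (hr1 s)
    simpa using (h2.const_mul (c / m)).neg

/-- The radial graph of an outgoing branch has the asymptotic slope `c / (n - 1) ξ / ξ'`. The error
`o(1)` is also `o(ξ' / ξ)`, as `ξ' / ξ` is bounded below. -/
theorem IsRadialInverse.hasSolitonSlope {n : ℕ} (hn : 2 ≤ n) {ξ : ℝ → ℝ}
    (hξ : IsWarpingFunction ξ) {c κ : ℝ} {r t σ : ℝ → ℝ} (hσ : IsRadialInverse r σ)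
    (h : IsProfile c ((n : ℝ) - 1) (fun ρ => deriv ξ ρ / ξ ρ) r t)
    (ho : IsOutgoing r) (hκ : 0 < κ) (hq : ∀ ρ, 0 < ρ → κ ≤ deriv ξ ρ / ξ ρ)
    (hlim : Tendsto (deriv fun r => ξ r / deriv ξ r) atTop (𝓝 0)) {R : ℝ} (hR : r 0 ≤ R) :
    HasSolitonSlope n ξ c R (fun ρ => t (σ ρ)) := by
  have hm : (0 : ℝ) < (n : ℝ) - 1 := by
    have : (2 : ℝ) ≤ n := by exact_mod_cast hn
    linarith
  have hd (ρ : ℝ) (hρ : 0 < ρ) : deriv ξ ρ ≠ 0 := by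
    intro h0
    have := hq ρ hρ
    rw [h0, zero_div] at this
    linarith
  refine ⟨fun ρ hρ => (hσ.hasDerivAt_graph h (hR.trans_lt hρ)).differentiableAt, ?_⟩
  have h1 := (h.tendsto_slope_sub ho hm hκ hq (P := fun r => ξ r / deriv ξ r)
    (fun ρ hρ => ((hasDerivAt_warping hξ ρ).div (hasDerivAt_deriv_warping hξ ρ)
      (hd ρ hρ)).differentiableAt)
    (fun ρ hρ => by have := hd ρ hρ; have := (hξ.pos ρ hρ).ne'; field_simp) hlim).comp hσ.tendsto
  have h2 : Tendsto (fun ρ => deriv (fun ρ => t (σ ρ)) ρ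
      - c / ((n : ℝ) - 1) * (ξ ρ / deriv ξ ρ)) atTop (𝓝 0) := by
    refine h1.congr' ?_
    filter_upwards [eventually_gt_atTop (r 0)] with ρ hρ
    rw [(hσ.hasDerivAt_graph h hρ).deriv]
    simp only [Function.comp, hσ.right_inv ρ hρ]
  refine ((isLittleO_one_iff ℝ).2 h2).trans_isBigO ?_
  refine IsBigO.of_bound κ⁻¹ ?_
  filter_upwards [eventually_gt_atTop 0] with ρ hρ
  have h3 := hq ρ hρ
  rw [norm_one, Real.norm_of_nonneg (hκ.le.trans h3), ← div_eq_inv_mul, le_div_iff₀ hκ, one_mul]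
  exact h3

/-! ### The order of the two sheets -/

/-- Positivity is preserved forward by a linear equation `D' = G D`. -/
theorem pos_of_hasDerivAt_mul {D G : ℝ → ℝ} {a b : ℝ} (hab : a ≤ b)
    (hD : ∀ x ∈ Set.Icc a b, HasDerivAt D (D x * G x) x) (hG : ContinuousOn G (Set.Icc a b))
    (ha : 0 < D a) : 0 < D b := by
  obtain ⟨C, hC⟩ := isCompact_Icc.exists_bound_of_continuousOn hG
  -- `D` cannot cross the exponential `D(a) exp (-(C + 1) (x - a))` from above
  have hf (x : ℝ) : HasDerivAt (fun x => D a * Real.exp (-(C + 1) * (x - a)))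
      (-(C + 1) * (D a * Real.exp (-(C + 1) * (x - a)))) x := by
    have := ((((hasDerivAt_id x).sub_const a).const_mul (-(C + 1))).exp).const_mul (D a)
    refine this.congr_deriv ?_
    simp
    ring
  have := image_le_of_deriv_right_lt_deriv_boundary' (a := a) (b := b)
    (fun x _ => (hf x).continuousAt.continuousWithinAt) (fun x _ => (hf x).hasDerivWithinAt)
    (by simp) (fun x hx => (hD x hx).continuousAt.continuousWithinAt)
    (fun x hx => (hD x (Set.Ico_subset_Icc_self hx)).hasDerivWithinAt)
    (fun x hx hx0 => by
      have h1 := hC x (Set.Ico_subset_Icc_self hx)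
      have h2 : 0 < D x := by rw [← hx0]; positivity
      have h3 := (abs_le.1 h1).1
      rw [hx0]
      nlinarith) (Set.right_mem_Icc.2 hab)
  exact (by positivity : 0 < D a * Real.exp (-(C + 1) * (b - a))).trans_le this

/-- Two outgoing branches starting at the same point, one upwards and one downwards, are strictly
ordered: near the starting point by the signs of `ṫ`; and the order of the slopes, which
solve the same first order equation, is then preserved. -/
theorem graph_lt_graph {c m : ℝ} {q r₁ t₁ r₂ t₂ σ₁ σ₂ : ℝ → ℝ}
    (h₁ : IsProfile c m q r₁ t₁) (h₂ : IsProfile c m q r₂ t₂) (ho₁ : IsOutgoing r₁)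
    (ho₂ : IsOutgoing r₂) (hσ₁ : IsRadialInverse r₁ σ₁) (hσ₂ : IsRadialInverse r₂ σ₂)
    (hr : r₂ 0 = r₁ 0) (ht : t₂ 0 = t₁ 0) (hr0 : 0 < r₁ 0) (hq : ContinuousOn q (Set.Ioi 0))
    (h1 : 0 < deriv t₁ 0) (h2 : deriv t₂ 0 < 0) {ρ : ℝ} (hρ : r₁ 0 < ρ) :
    t₂ (σ₂ ρ) < t₁ (σ₁ ρ) := by
  obtain ⟨d, hd, hd'⟩ : ∃ d > 0, ∀ s ∈ Set.Icc 0 d, 0 < deriv t₁ s ∧ deriv t₂ s < 0 := by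
    have e1 := (h₁.hasDerivAt_deriv_t 0).continuousAt.eventually_const_lt h1
    have e2 := (h₂.hasDerivAt_deriv_t 0).continuousAt.eventually_lt_const h2
    obtain ⟨η, hη, hη'⟩ := Metric.eventually_nhds_iff.1 (e1.and e2)
    refine ⟨η / 2, by positivity, fun s hs => hη' ?_⟩
    rw [Real.dist_eq, sub_zero, abs_of_nonneg hs.1]
    linarith [hs.2]
  have hm₁ := h₁.strictMonoOn_r ho₁
  have hm₂ := h₂.strictMonoOn_r ho₂
  have hσlt {r t σ : ℝ → ℝ} (h : IsProfile c m q r t) (ho : IsOutgoing r)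
      (hσ : IsRadialInverse r σ) {x : ℝ} (hx : r 0 < x) (hxd : x ≤ r d) :
      σ x ∈ Set.Ioc 0 d :=
    ⟨hσ.pos x hx, ((h.strictMonoOn_r ho).le_iff_le (hσ.pos x hx).le hd.le).1
      (by rwa [hσ.right_inv x hx])⟩
  set ρ₀ := min (r₁ d) (r₂ d) with hρ₀
  have hρ₀1 : r₁ 0 < ρ₀ := lt_min (hm₁ Set.self_mem_Ici hd.le hd)
    (hr ▸ hm₂ Set.self_mem_Ici hd.le hd)
  have hnear {x : ℝ} (hx : r₁ 0 < x) (hx0 : x ≤ ρ₀) :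
      t₂ (σ₂ x) < t₁ (σ₁ x) ∧
        0 < deriv t₁ (σ₁ x) / deriv r₁ (σ₁ x) - deriv t₂ (σ₂ x) / deriv r₂ (σ₂ x) := by
    have m1 := hσlt h₁ ho₁ hσ₁ hx (hx0.trans (min_le_left _ _))
    have m2 := hσlt h₂ ho₂ hσ₂ (hr.symm ▸ hx) (hx0.trans (min_le_right _ _))
    constructor
    · have a1 : StrictMonoOn t₁ (Set.Icc 0 d) := strictMonoOn_of_deriv_pos (convex_Icc 0 d)
        (fun y _ => (h₁.hasDerivAt_t y).continuousAt.continuousWithinAt)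
        fun y hy => (hd' y (interior_subset hy)).1
      have a2 : StrictAntiOn t₂ (Set.Icc 0 d) := strictAntiOn_of_deriv_neg (convex_Icc 0 d)
        (fun y _ => (h₂.hasDerivAt_t y).continuousAt.continuousWithinAt)
        fun y hy => (hd' y (interior_subset hy)).2
      have b1 := a1 (Set.left_mem_Icc.2 hd.le) (Set.Ioc_subset_Icc_self m1) m1.1
      have b2 := a2 (Set.left_mem_Icc.2 hd.le) (Set.Ioc_subset_Icc_self m2) m2.1
      linarith
    · have b1 := div_pos (hd' _ (Set.Ioc_subset_Icc_self m1)).1 (ho₁.deriv_pos _ m1.1)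
      have b2 := div_neg_of_neg_of_pos (hd' _ (Set.Ioc_subset_Icc_self m2)).2
        (ho₂.deriv_pos _ m2.1)
      linarith
  rcases le_or_gt ρ ρ₀ with hle | hgt
  · exact (hnear hρ hle).1
  have hp₁ {x : ℝ} (hx : ρ₀ ≤ x) := hσ₁.hasDerivAt_slope h₁ ho₁ (hρ₀1.trans_le hx)
  have hp₂ {x : ℝ} (hx : ρ₀ ≤ x) := hσ₂.hasDerivAt_slope h₂ ho₂ (hr.symm ▸ hρ₀1.trans_le hx)
  set p₁ : ℝ → ℝ := fun x => deriv t₁ (σ₁ x) / deriv r₁ (σ₁ x) with hp₁_def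
  set p₂ : ℝ → ℝ := fun x => deriv t₂ (σ₂ x) / deriv r₂ (σ₂ x) with hp₂_def
  have hpos {x : ℝ} (hx : ρ₀ ≤ x) : 0 < p₁ x - p₂ x := by
    refine pos_of_hasDerivAt_mul (D := fun x => p₁ x - p₂ x) (G := fun x => c * (p₁ x + p₂ x)
      - m * q x * (1 + p₁ x ^ 2 + p₁ x * p₂ x + p₂ x ^ 2)) hx (fun y hy => ?_) ?_
      (hnear hρ₀1 le_rfl).2
    · refine ((hp₁ hy.1).sub (hp₂ hy.1)).congr_deriv ?_
      simp only [hp₁_def, hp₂_def]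
      ring
    · have c1 : ContinuousOn p₁ (Set.Icc ρ₀ x) := fun y hy =>
        (hp₁ hy.1).continuousAt.continuousWithinAt
      have c2 : ContinuousOn p₂ (Set.Icc ρ₀ x) := fun y hy =>
        (hp₂ hy.1).continuousAt.continuousWithinAt
      have c3 : ContinuousOn q (Set.Icc ρ₀ x) :=
        hq.mono fun y hy => (hr0.trans hρ₀1).trans_le hy.1
      fun_prop
  have hdiff {x : ℝ} (hx : ρ₀ ≤ x) :
      HasDerivAt (fun x => t₁ (σ₁ x) - t₂ (σ₂ x)) (p₁ x - p₂ x) x :=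
    (hσ₁.hasDerivAt_graph h₁ (hρ₀1.trans_le hx)).sub
      (hσ₂.hasDerivAt_graph h₂ (hr.symm ▸ hρ₀1.trans_le hx))
  have hmono : StrictMonoOn (fun x => t₁ (σ₁ x) - t₂ (σ₂ x)) (Set.Ici ρ₀) := by
    refine strictMonoOn_of_deriv_pos (convex_Ici ρ₀)
      (fun x hx => (hdiff hx).continuousAt.continuousWithinAt) fun x hx => ?_
    rw [(hdiff (interior_subset hx)).deriv]
    exact hpos (interior_subset hx)
  have := hmono Set.self_mem_Ici hgt.le hgt
  have h3 := (hnear hρ₀1 le_rfl).1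
  simp only at this
  linarith

/-! ### Rotationally symmetric solitons as graphs -/

theorem mem_image_rotMap_iff {n : ℕ} {r t : ℝ → ℝ} {τ : ℝ} {x : EuclideanSpace ℝ (Fin n)}
    (hx : 0 < ‖x‖) :
    (τ, x) ∈ rotMap r t '' rotParam n ↔ ∃ s, |r s| = ‖x‖ ∧ t s = τ := by
  constructor
  · rintro ⟨⟨s, ϑ⟩, hϑ, h⟩
    have hϑ : ‖ϑ‖ = 1 := hϑ
    obtain ⟨h1, h2⟩ := Prod.ext_iff.1 h
    refine ⟨s, ?_, h1⟩
    have h2 : r s • ϑ = x := h2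
    rw [← h2, norm_smul, hϑ, mul_one, Real.norm_eq_abs]
  · rintro ⟨s, hs, rfl⟩
    have hr : r s ≠ 0 := by rw [← abs_pos, hs]; exact hx
    refine ⟨(s, (r s)⁻¹ • x), ?_, ?_⟩
    · change ‖(r s)⁻¹ • x‖ = 1
      rw [norm_smul, norm_inv, Real.norm_eq_abs, hs, inv_mul_cancel₀ hx.ne']
    · simp [rotMap, smul_smul, hr]

theorem exists_graph_of_bowl {n : ℕ} (hn : 2 ≤ n) {ξ : ℝ → ℝ} (hξ : IsWarpingFunction ξ)
    {c κ R : ℝ} {r t : ℝ → ℝ}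
    (h : IsProfile c ((n : ℝ) - 1) (fun ρ => deriv ξ ρ / ξ ρ) r t) (ho : IsOutgoing r)
    (hκ : 0 < κ) (hq : ∀ ρ, 0 < ρ → κ ≤ deriv ξ ρ / ξ ρ)
    (hlim : Tendsto (deriv fun r => ξ r / deriv ξ r) atTop (𝓝 0))
    (hR : 0 < R) (h0 : r 0 = 0) (hr : ∀ s, r (-s) = -r s) (ht : ∀ s, t (-s) = t s) :
    ∃ u : ℝ → ℝ, (∀ (τ : ℝ) (x : EuclideanSpace ℝ (Fin n)), R < ‖x‖ →
      ((τ, x) ∈ rotMap r t '' rotParam n ↔ τ = u ‖x‖)) ∧ HasSolitonSlope n ξ c R u := by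
  have hm : (0 : ℝ) < (n : ℝ) - 1 := by
    have : (2 : ℝ) ≤ n := by exact_mod_cast hn
    linarith
  obtain ⟨σ, hσ⟩ := h.exists_isRadialInverse ho hm hκ hq
  refine ⟨fun ρ => t (σ ρ), fun τ x hx => ?_,
    hσ.hasSolitonSlope hn hξ h ho hκ hq hlim (h0.le.trans hR.le)⟩
  have hx0 : 0 < ‖x‖ := hR.trans hx
  rw [mem_image_rotMap_iff hx0]
  beta_reduce
  constructor
  · rintro ⟨s, hs, rfl⟩
    rcases lt_trichotomy s 0 with hs0 | rfl | hs0
    · have hs1 : 0 < -s := neg_pos.2 hs0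
      have h1 : r (-s) = ‖x‖ := by
        rw [← hs, ← abs_neg, ← hr, abs_of_pos (ho.pos _ hs1)]
      rw [← h1, hσ.left_inv _ hs1, ht]
    · rw [h0, abs_zero] at hs
      exact absurd hs hx0.ne
    · rw [abs_of_pos (ho.pos s hs0)] at hs
      rw [← hs, hσ.left_inv s hs0]
  · rintro rfl
    have hr0 : r 0 < ‖x‖ := h0.symm ▸ hx0
    exact ⟨σ ‖x‖, by rw [hσ.right_inv _ hr0, abs_of_pos hx0], rfl⟩

theorem exists_bigraph_of_wing {n : ℕ} (hn : 2 ≤ n) {ξ : ℝ → ℝ} (hξ : IsWarpingFunction ξ)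
    {c κ : ℝ} {r t : ℝ → ℝ}
    (h : IsProfile c ((n : ℝ) - 1) (fun ρ => deriv ξ ρ / ξ ρ) r t) (hpos : ∀ s, 0 < r s)
    (hκ : 0 < κ) (hq : ∀ ρ, 0 < ρ → κ ≤ deriv ξ ρ / ξ ρ)
    (hlim : Tendsto (deriv fun r => ξ r / deriv ξ r) atTop (𝓝 0))
    (hr0 : deriv r 0 = 0) (ht0 : 0 < deriv t 0) :
    ∃ u₁ u₂ : ℝ → ℝ, (∀ ρ, r 0 < ρ → u₂ ρ < u₁ ρ) ∧
      (∀ (τ : ℝ) (x : EuclideanSpace ℝ (Fin n)), r 0 < ‖x‖ →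
        ((τ, x) ∈ rotMap r t '' rotParam n ↔ τ = u₁ ‖x‖ ∨ τ = u₂ ‖x‖)) ∧
      HasSolitonSlope n ξ c (r 0) u₁ ∧ HasSolitonSlope n ξ c (r 0) u₂ := by
  have hm : (0 : ℝ) < (n : ℝ) - 1 := by
    have : (2 : ℝ) ≤ n := by exact_mod_cast hn
    linarith
  have hq0 : ∀ ρ, 0 < ρ → 0 < deriv ξ ρ / ξ ρ := fun ρ hρ => hκ.trans_le (hq ρ hρ)
  have h' := h.reverse
  have hdr : deriv (fun s => r (-s)) 0 = 0 := by rw [deriv_comp_neg, neg_zero, hr0, neg_zero]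
  have hdt : deriv (fun s => t (-s)) 0 = -deriv t 0 := by rw [deriv_comp_neg, neg_zero]
  have ho := h.isOutgoing hm hq0 (fun s _ => hpos s) hr0.ge fun _ => hpos 0
  have ho' := h'.isOutgoing hm hq0 (fun s _ => hpos (-s)) hdr.ge fun _ => hpos _
  obtain ⟨σ, hσ⟩ := h.exists_isRadialInverse ho hm hκ hq
  obtain ⟨σ', hσ'⟩ := h'.exists_isRadialInverse ho' hm hκ hq
  have hr00 : r (-0) = r 0 := by rw [neg_zero]
  have hqc : ContinuousOn (fun ρ => deriv ξ ρ / ξ ρ) (Set.Ioi 0) := fun ρ hρ =>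
    ((hasDerivAt_deriv_warping hξ ρ).continuousAt.div (hasDerivAt_warping hξ ρ).continuousAt
      (hξ.pos ρ hρ).ne').continuousWithinAt
  refine ⟨fun ρ => t (σ ρ), fun ρ => t (-σ' ρ), fun ρ hρ => ?_, fun τ x hx => ?_,
    hσ.hasSolitonSlope hn hξ h ho hκ hq hlim le_rfl,
    hσ'.hasSolitonSlope hn hξ h' ho' hκ hq hlim hr00.le⟩
  · exact graph_lt_graph h h' ho ho' hσ hσ' hr00 (by simp) (hpos 0) hqc ht0
      (by rw [hdt]; linarith) hρ
  · have hx0 : 0 < ‖x‖ := (hpos 0).trans hx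
    rw [mem_image_rotMap_iff hx0]
    beta_reduce
    constructor
    · rintro ⟨s, hs, rfl⟩
      rw [abs_of_pos (hpos s)] at hs
      rcases lt_trichotomy s 0 with hs0 | rfl | hs0
      · have := hσ'.left_inv (-s) (neg_pos.2 hs0)
        rw [neg_neg, hs] at this
        right
        rw [this, neg_neg]
      · exact absurd hs hx.ne
      · left
        rw [← hs, hσ.left_inv s hs0]
    · rintro (rfl | rfl)
      · exact ⟨σ ‖x‖, by rw [hσ.right_inv _ hx, abs_of_pos hx0], rfl⟩
      · exact ⟨-σ' ‖x‖, by rw [hσ'.right_inv _ (hr00.symm ▸ hx), abs_of_pos hx0], rfl⟩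

theorem image_rotMap_reverse {n : ℕ} (r t : ℝ → ℝ) :
    rotMap (fun s => r (-s)) (fun s => t (-s)) '' rotParam n = rotMap r t '' rotParam n := by
  ext p
  constructor
  · rintro ⟨⟨s, ϑ⟩, h, rfl⟩; exact ⟨(-s, ϑ), h, rfl⟩
  · rintro ⟨⟨s, ϑ⟩, h, rfl⟩; exact ⟨(-s, ϑ), h, by simp [rotMap]⟩

theorem mainTheorem8 (n : ℕ) (hn : 2 ≤ n) (ξ : ℝ → ℝ) (hξ : IsWarpingFunction ξ)
    (Kminus Kplus : ℝ) (hKplus : Kplus < 0)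
    (hK : ∀ x u v : EuclideanSpace ℝ (Fin n), LinearIndependent ℝ ![u, v] →
      Kminus ≤ sectionalCurvature (rotMetric n ξ) x u v ∧
        sectionalCurvature (rotMetric n ξ) x u v ≤ Kplus)
    (hlim : Tendsto (deriv fun r => ξ r / deriv ξ r) atTop (𝓝 0))
    (c ε : ℝ) (hε : 0 ≤ ε)
    (M : Set (ℝ × EuclideanSpace ℝ (Fin n))) (r t : ℝ → ℝ)
    (hM : IsRotSoliton n ξ c ε M r t) :
    ∃ R : ℝ, 0 < R ∧
      (ε = 0 → ∃ u : ℝ → ℝ,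
        (∀ (τ : ℝ) (x : EuclideanSpace ℝ (Fin n)), R < ‖x‖ →
          ((τ, x) ∈ M ↔ τ = u ‖x‖)) ∧
        HasSolitonSlope n ξ c R u) ∧
      (0 < ε → ∃ u₁ u₂ : ℝ → ℝ,
        (∀ ρ, R < ρ → u₂ ρ < u₁ ρ) ∧
        (∀ (τ : ℝ) (x : EuclideanSpace ℝ (Fin n)), R < ‖x‖ →
          ((τ, x) ∈ M ↔ τ = u₁ ‖x‖ ∨ τ = u₂ ‖x‖)) ∧
        HasSolitonSlope n ξ c R u₁ ∧ HasSolitonSlope n ξ c R u₂) := by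
  have hm : (0 : ℝ) < (n : ℝ) - 1 := by
    have : (2 : ℝ) ≤ n := by exact_mod_cast hn
    linarith
  have hk : 0 < -Kplus := neg_pos.2 hKplus
  have hq : ∀ ρ, 0 < ρ → √(-Kplus) ≤ deriv ξ ρ / ξ ρ := fun ρ =>
    sqrt_le_log_deriv_warping hξ hk fun ρ =>
      warping_second_deriv_ge hn hξ fun x u v huv => (hK x u v huv).2
  have hκ : 0 < √(-Kplus) := Real.sqrt_pos.2 hk
  have h : IsProfile c ((n : ℝ) - 1) (fun ρ => deriv ξ ρ / ξ ρ) r t :=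
    ⟨hM.contDiff_r, hM.contDiff_t, hM.arclength, fun s hs =>
      profile_equation hn hξ hM.contDiff_r hM.contDiff_t hM.arclength hM.soliton hs⟩
  rw [hM.image]
  rcases hε.eq_or_lt with rfl | hε
  · obtain ⟨h1, hpos, hr, ht⟩ := hM.bowl rfl
    refine ⟨1, one_pos, fun _ => ?_, fun h0 => absurd h0 (lt_irrefl _)⟩
    exact exists_graph_of_bowl hn hξ h
      (h.isOutgoing hm (fun ρ hρ => hκ.trans_le (hq ρ hρ)) hpos (by rw [h1]; exact zero_le_one)
        fun h0 => absurd (h1.symm.trans h0) one_ne_zero)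
      hκ hq hlim one_pos hM.start hr ht
  · obtain ⟨h1, hpos⟩ := hM.wing hε
    refine ⟨ε, hε, fun h0 => absurd h0 hε.ne', fun _ => ?_⟩
    have ht0 : deriv t 0 ≠ 0 := by
      intro h0
      have := hM.arclength 0
      rw [h0, h1] at this
      norm_num at this
    rw [← hM.start]
    -- after reversing the curve if necessary, the branch `s > 0` is the upper sheet
    rcases ht0.lt_or_gt with hneg | hpos'
    · have := exists_bigraph_of_wing hn hξ h.reverse (fun s => hpos (-s)) hκ hq hlim
        (by rw [deriv_comp_neg, neg_zero, h1, neg_zero])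
        (by rw [deriv_comp_neg, neg_zero]; linarith)
      simpa only [image_rotMap_reverse, neg_zero] using this
    · exact exists_bigraph_of_wing hn hξ h hpos hκ hq hlim h1 hpos'
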